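/- Let $p\ge 2$ be an integer, $q=2p$, $\lambda=2\cos\frac{\pi}{q}$, and $\frac12\le\alpha\le\frac1\lambda$. Put $I_{q,\alpha}=[\lambda(\alpha-1),\lambda\alpha]$. For $x\ne0$ let $\varepsilon(x)=\operatorname{sgn}(x)$, $d(x)=\left\lfloor\left|\frac1{x\lambda}\right|+1-\alpha\right\rfloor$ and $$T_\alpha(x)=\left|\tfrac1x\right|-\lambda\, d(x),\qquad \mathcal T_\alpha(x,y)=\left(T_\alpha(x),\ \frac1{d(x)\lambda+\varepsilon(x)y}\right),$$ and let $T_\alpha(0)=0$, $\mathcal T_\alpha(0,y)=(0,0)$. Let $\ell_n=T_\alpha^n((\alpha-1)\lambda)$, $r_n=T_\alpha^n(\alpha\lambda)$ for $n\ge0$, and $B_n=\sin\frac{n\pi}q/\sin\frac\pi q$ for $n\in\mathbb Z$. Define $$H_{2n}=\frac{B_n}{B_{n+1}}\ (1\le n\le p-1),\qquad H_{2n-1}=\frac{B_{p-n}-B_{p+1-n}}{B_{p-1-n}-B_{p-n}}\ (1\le n\le p).$$ For $\frac12\le\alpha<\frac1\lambda$ let $\Omega_\alpha=\bigcup_{n=1}^{2p-1}J_n\times[0,H_n]$,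 where $J_{2n-1}=[\ell_{n-1},r_n)$ and $J_{2n}=[r_n,\ell_n)$ for $1\le n\le p-1$, and $J_{2p-1}=[\ell_{p-1},r_0)$ (for $\alpha=\frac12$ the intervals $J_{2n}$ are empty). For $\alpha=\frac1\lambda$ let $$\Omega_{1/\lambda}=\bigcup_{n=1}^{p-1}\left[\frac{B_n-B_{n+1}}{B_n-B_{n-1}},\frac{B_{n+1}-B_{n+2}}{B_{n+1}-B_n}\right)\times\left[0,\frac{B_n}{B_{n+1}}\right].$$ Let $\nu_\alpha$ be the probability measure on $\Omega_\alpha$ with density $C_{q,\alpha}/(1+xy)^2$ with respect to Lebesgue measure, $C_{q,\alpha}$ being the normalizing constant; let $\mu_\alpha$ be the image of $\nu_\alpha$ under the projection $\pi(x,y)=x$; and let $\bar{\mathcal B}$ and $\mathcal B$ be the $\sigma$-algebras of Lebesgue measurable sets on $\Omega_\alpha$ and on $I_{q,\alpha}$. Then $(\Omega_\alpha,\bar{\mathcal B},\nu_\alpha,\mathcal T_\alpha)$ is the (Rohlin) natural extension of $(I_{q,\alpha},\mathcal B,\mu_\alpha,T_\alpha)$, with factor map $\pi$. That is: both are measure-preserving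 dynamical systems on probability spaces; $\mathcal T_\alpha$ is invertible up to $\nu_\alpha$-null sets, with measure-preserving inverse; $\pi$ maps $\Omega_\alpha$ into $I_{q,\alpha}$, sends $\nu_\alpha$ to $\mu_\alpha$ and satisfies $\pi\circ\mathcal T_\alpha=T_\alpha\circ\pi$ almost everywhere; and, modulo $\nu_\alpha$-null sets, $\bar{\mathcal B}$ is the smallest $\sigma$-algebra that contains $\pi^{-1}(\mathcal B)$ and is invariant under $\mathcal T_\alpha$ and its inverse. -/

import Mathlib

open MeasureTheory Set

noncomputable section

namespace AlphaRosen

/-! ### Measure-theoretic dynamical systems and natural extensions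

A system is given by a carrier set `C` inside an ambient measurable space `X`, a probability measure
`ρ` concentrated on `C`, and a map `S`. As usual in ergodic theory, invertibility, factor maps and
equality of σ-algebras are understood up to sets of measure zero. -/

/-- `(C, ρ, S)` is a (probability) measure-preserving dynamical system. -/
structure IsDynamicalSystem {X : Type*} [MeasurableSpace X] (C : Set X) (ρ : Measure X)
    (S : X → X) : Prop where
  isProbabilityMeasure : IsProbabilityMeasure ρ
  measurableSet_carrier : MeasurableSet C
  measure_compl_carrier : ρ Cᶜ = 0
  mapsTo : MapsTo S C C
  measurePreserving : MeasurePreserving S ρ ρ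

/-- `S` is invertible modulo `ρ`-null sets, with measure-preserving inverse. -/
def IsInvertibleMod {X : Type*} [MeasurableSpace X] (ρ : Measure X) (S : X → X) : Prop :=
  ∃ R : X → X, MeasurePreserving R ρ ρ ∧ (∀ᵐ x ∂ρ, R (S x) = x) ∧ (∀ᵐ x ∂ρ, S (R x) = x)

/-- The sub-σ-algebras `𝓒` of the σ-algebra of `X` that contain the measurable `ρ`-null sets and
the σ-algebra `π⁻¹(𝓑)` (`𝓑` the σ-algebra of `Y`), and that are invariant under the invertible map
`S` in both directions: `S⁻¹𝓒 = 𝓒`. -/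
def invariantSubalgebras {X Y : Type*} [mX : MeasurableSpace X] [mY : MeasurableSpace Y]
    (ρ : Measure X) (S : X → X) (π : X → Y) : Set (MeasurableSpace X) :=
  {𝓒 | 𝓒 ≤ mX ∧
    (∀ N : Set X, MeasurableSet[mX] N → ρ N = 0 → MeasurableSet[𝓒] N) ∧
    (∀ B : Set Y, MeasurableSet[mY] B → MeasurableSet[𝓒] (π ⁻¹' B)) ∧
    (∀ A : Set X, MeasurableSet[mX] A →
      (MeasurableSet[𝓒] (S ⁻¹' A) ↔ MeasurableSet[𝓒] A))}

/-- `(C, ρ, S)` is a (Rohlin) natural extension of `(D, μ, T)` with factor map `π`: it is an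
invertible dynamical system, `π` is a factor map onto `(D, μ, T)`, and the σ-algebra of `X` is the
smallest `S`-invariant σ-algebra containing the preimages under `π` of the measurable sets
of `Y`. -/
structure IsNaturalExtension {X Y : Type*} [mX : MeasurableSpace X] [MeasurableSpace Y]
    (C : Set X) (ρ : Measure X) (S : X → X)
    (D : Set Y) (μ : Measure Y) (T : Y → Y) (π : X → Y) : Prop where
  isDynamicalSystem : IsDynamicalSystem C ρ S
  isInvertible : IsInvertibleMod ρ S
  base_isDynamicalSystem : IsDynamicalSystem D μ T
  factor_mapsTo : MapsTo π C D
  factor_measurePreserving : MeasurePreserving π ρ μ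
  factor_comm : ∀ᵐ x ∂ρ, π (S x) = T (π x)
  isLeast_invariant : IsLeast (invariantSubalgebras ρ S π) mX

/-! ### `α`-Rosen fractions -/

/-- `λ_q = 2 cos (π / q)`. -/
def lam (q : ℕ) : ℝ := 2 * Real.cos (Real.pi / q)

/-- The interval `I_{q,α} = [λ(α - 1), αλ]`. -/
def I (q : ℕ) (α : ℝ) : Set ℝ := Icc (lam q * (α - 1)) (α * lam q)

/-- The digit `d(x) = ⌊|1/(xλ)| + 1 - α⌋` for `x ≠ 0`; it is never used at `x = 0`,
where `d(0) = ∞`. -/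
def digit (q : ℕ) (α x : ℝ) : ℤ := ⌊|1 / (x * lam q)| + 1 - α⌋

/-- The map `T_α`. -/
def T (q : ℕ) (α x : ℝ) : ℝ :=
  if x = 0 then 0 else |1 / x| - lam q * digit q α x

/-- The map `𝒯_α(x, y) = (T_α(x), 1 / (d(x) λ + ε(x) y))`; since `d(0) = ∞`, the second coordinate
is `0` for `x = 0`. -/
def natMap (q : ℕ) (α : ℝ) (z : ℝ × ℝ) : ℝ × ℝ :=
  (T q α z.1, if z.1 = 0 then 0 else 1 / (digit q α z.1 * lam q + Real.sign z.1 * z.2))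

/-- The orbit `ℓ_n = T_α^n(ℓ_0)` of the left endpoint `ℓ_0 = (α - 1)λ`. -/
def l (q : ℕ) (α : ℝ) (n : ℕ) : ℝ := (T q α)^[n] ((α - 1) * lam q)

/-- The orbit `r_n = T_α^n(r_0)` of the right endpoint `r_0 = αλ`. -/
def r (q : ℕ) (α : ℝ) (n : ℕ) : ℝ := (T q α)^[n] (α * lam q)

/-- `B_n = sin(nπ/q) / sin(π/q)`, the solution of `B_0 = 0`, `B_1 = 1`,
`B_n = λ B_{n-1} - B_{n-2}`. -/
def B (q : ℕ) (n : ℤ) : ℝ := Real.sin (n * Real.pi / q) / Real.sin (Real.pi / q)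

/-- The height `H_{2n} = B_n / B_{n+1}`, for `q = 2p` and `1 ≤ n ≤ p - 1`. -/
def HEven (p n : ℕ) : ℝ := B (2 * p) n / B (2 * p) (n + 1)

/-- The height `H_{2n-1} = (B_{p-n} - B_{p+1-n}) / (B_{p-1-n} - B_{p-n})`, for `q = 2p`
and `1 ≤ n ≤ p`. -/
def HOdd (p n : ℕ) : ℝ :=
  (B (2 * p) (p - n) - B (2 * p) (p + 1 - n)) / (B (2 * p) (p - 1 - n) - B (2 * p) (p - n))

/-- The domain for `1/2 ≤ α < 1/λ`, `q = 2p`: the union of the rectangles `J_n × [0, H_n]`,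
`1 ≤ n ≤ 2p - 1`, with `J_{2n-1} = [ℓ_{n-1}, r_n)` and `J_{2n} = [r_n, ℓ_n)` for `1 ≤ n ≤ p - 1`, and
`J_{2p-1} = [ℓ_{p-1}, r_0)`. For `α = 1/2` the intervals `J_{2n}` are empty. -/
def OmegaGen (p : ℕ) (α : ℝ) : Set (ℝ × ℝ) :=
  (⋃ n ∈ Icc 1 (p - 1),
      Ico (l (2 * p) α (n - 1)) (r (2 * p) α n) ×ˢ Icc 0 (HOdd p n) ∪
      Ico (r (2 * p) α n) (l (2 * p) α n) ×ˢ Icc 0 (HEven p n)) ∪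
    Ico (l (2 * p) α (p - 1)) (r (2 * p) α 0) ×ˢ Icc 0 (HOdd p p)

/-- The domain for `α = 1/λ`, `q = 2p`. -/
def OmegaTop (p : ℕ) : Set (ℝ × ℝ) :=
  ⋃ n ∈ Icc 1 (p - 1),
    Ico ((B (2 * p) n - B (2 * p) (n + 1)) / (B (2 * p) n - B (2 * p) (n - 1)))
        ((B (2 * p) (n + 1) - B (2 * p) (n + 2)) / (B (2 * p) (n + 1) - B (2 * p) n)) ×ˢ
      Icc 0 (B (2 * p) n / B (2 * p) (n + 1))

/-- The domain `Ω_α` for `q = 2p` and `1/2 ≤ α ≤ 1/λ`. -/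
def Omega (p : ℕ) (α : ℝ) : Set (ℝ × ℝ) :=
  if α = 1 / lam (2 * p) then OmegaTop p else OmegaGen p α

/-- The real line with the σ-algebra of Lebesgue measurable sets. -/
abbrev LebesgueLine : Type := NullMeasurableSpace ℝ (volume : Measure ℝ)

/-- The plane with the σ-algebra of Lebesgue measurable sets. -/
abbrev LebesguePlane : Type := NullMeasurableSpace (ℝ × ℝ) (volume : Measure (ℝ × ℝ))

/-- The constant normalizing the density `1 / (1 + xy)²` on `Ω_α`. -/
def normConst (p : ℕ) (α : ℝ) : ℝ := (∫ z in Omega p α, 1 / (1 + z.1 * z.2) ^ 2)⁻¹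

/-- The measure `ν_α` with density `C_{q,α} / (1 + xy)²` on `Ω_α` with respect to two-dimensional
Lebesgue measure, on the Lebesgue measurable sets. -/
def nu (p : ℕ) (α : ℝ) : Measure LebesguePlane :=
  ((volume : Measure (ℝ × ℝ)).completion.restrict (Omega p α)).withDensity
    fun z : ℝ × ℝ => ENNReal.ofReal (normConst p α / (1 + z.1 * z.2) ^ 2)

/-- The projection on the first coordinate. -/
def proj : LebesguePlane → LebesgueLine := fun z : ℝ × ℝ => z.1

/-- The measure `μ_α`, the projection of `ν_α` on the first coordinate. -/
def mu (p : ℕ) (α : ℝ) : Measure LebesgueLine := (nu p α).map proj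

end AlphaRosen

end

noncomputable section

namespace AlphaRosen

/-! Put t = αλ. Following the two endpoints along the digit-one branches and interlacing the orbits
gives thresholds c_1 ≤ ... ≤ c_{2p-1}, and Ω_α is the region under an increasing step function with
heights H_k over them. The branch x ↦ -1/x - λ carries c_k to c_{k+2} while y ↦ 1/(λ - y) carries
H_k to H_{k+2}; this is why 𝒯_α maps the region into itself (`Staircase.natMap_mem_region`).

The map is injective off a null set (`Staircase.injOn_natMap`). When the first coordinates have
equal signs, the digits agree because fibres have length at most 1 < λ. When the signs are opposite,
equal images force y + y' = λ. The endpoint orbits meet again (field `gap`), and this pairs the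
fibres so that y + y' is at most λ/2 + λ/2 or 1 + (λ - 1); a collision therefore needs y' = λ/2 or
y' = λ - 1.

A Jacobian computation (`abs_det_mul_density`) shows that the density 1/(1 + xy)² is respected, so
images keep their measure. As the total mass is finite, the image of a full-measure set is again of
full measure: surjectivity almost everywhere needs no separate argument (`exists_inverse`).

For minimality of the σ-algebra, two steps of the map contract vertical fibres by a factor below 1
(`Staircase.abs_snd_iterate_sub_le`). Hence y is a limit of functions of the first coordinates of
the preimages of (x, y) (`Staircase.tendsto_snd_past`), and these are measurable for any invariant
σ-algebra containing the preimages under π.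

The numbers B_n serve only to verify the axioms of `Staircase` (`isStaircase`) and to identify the
two descriptions of Ω_α with `region`. The analysis is done on Borel sets and transferred to
Lebesgue measurable sets by `IsLift`. -/

/-- The combinatorial data describing a region under a step function: the thresholds
`c 1 ≤ c 2 ≤ ⋯ ≤ c (M + 2)` and the heights `H 1 ≤ H 2 ≤ ⋯ ≤ H (M + 2)`. -/
structure Staircase (L t : ℝ) (M : ℕ) (c H : ℕ → ℝ) : Prop where
  le_L : 7 / 5 ≤ L
  L_lt : L < 2
  le_t : L / 2 ≤ t
  t_le : t ≤ 1
  one_le : 1 ≤ M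
  c_one : c 1 = t - L
  c_two : c 2 = 1 / t - L
  c_step : ∀ k, 1 ≤ k → k ≤ M → c (k + 2) = -1 / c k - L
  c_neg : ∀ k, 1 ≤ k → k ≤ M → c k < 0
  c_mono : ∀ j k, 1 ≤ j → j ≤ k → k ≤ M + 2 → c j ≤ c k
  c_last : c (M + 2) ≤ t
  -- The cases arise from t = L/2 and t > L/2. In the second the endpoint orbits meet: c (M + 1) and
  -- c (M + 2) have the same image, with digits differing by one.
  gap : (c (M + 2) = 0 ∧ c (M + 1) = 0) ∨
    (0 < c (M + 2) ∧ c (M + 1) < 0 ∧ -1 / c (M + 1) = 1 / c (M + 2) + L)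
  H_one : H 1 = 1 / (L + 1)
  H_two : H 2 = 1 / L
  H_step : ∀ k, 1 ≤ k → k ≤ M → H (k + 2) = 1 / (L - H k)
  H_mono : ∀ j k, 1 ≤ j → j ≤ k → k ≤ M + 2 → H j ≤ H k
  -- H M + H (M + 2) and 2 * H (M + 1) both equal L: this keeps images of fibres over opposite signs
  -- from overlapping.
  H_low : H M = L - 1
  H_mid : H (M + 1) = L / 2
  H_top : H (M + 2) = 1

/-- The region under the step function with thresholds `c` and heights `H`. -/
def region (t : ℝ) (M : ℕ) (c H : ℕ → ℝ) : Set (ℝ × ℝ) :=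
  {z | c 1 ≤ z.1 ∧ z.1 < t ∧ 0 ≤ z.2 ∧ ∃ k, 1 ≤ k ∧ k ≤ M + 2 ∧ c k ≤ z.1 ∧ z.2 ≤ H k}

/-- The part of the region where the natural extension map is injective and differentiable. -/
def core (q : ℕ) (α : ℝ) (M : ℕ) (c H : ℕ → ℝ) : Set (ℝ × ℝ) :=
  {z | z ∈ region (α * lam q) M c H ∧ z.1 ≠ 0 ∧ z.1 ≠ c (M + 1) ∧ z.2 ≠ 0 ∧
    z.2 ≠ lam q / 2 ∧ z.2 ≠ lam q - 1 ∧ ∀ n : ℤ, |1 / (z.1 * lam q)| + 1 - α ≠ n}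

/-- The contraction ratio of two consecutive iterates. -/
def ratio (L : ℝ) : ℝ := max (L / 2) (1 / L)

theorem T_mem_Ico {q : ℕ} {α x : ℝ} (hL : 0 < lam q) (hx : x ≠ 0) :
    T q α x ∈ Ico (α * lam q - lam q) (α * lam q) := by
  have h1 : |1 / (x * lam q)| * lam q = |1 / x| := by
    rw [abs_div, abs_div, abs_mul, abs_of_pos hL]
    have : |x| ≠ 0 := abs_ne_zero.mpr hx
    field_simp
  have h2 := Int.floor_le (|1 / (x * lam q)| + 1 - α)
  have h3 := Int.lt_floor_add_one (|1 / (x * lam q)| + 1 - α)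
  simp only [T, if_neg hx, digit, mem_Ico]
  rw [← h1]
  constructor <;> nlinarith

theorem T_add {q : ℕ} {α x : ℝ} (hx : x ≠ 0) :
    |1 / x| = T q α x + lam q * digit q α x := by
  simp [T, hx]

theorem digit_eq_of_mem_Ico {q : ℕ} {α x : ℝ} (hL : 0 < lam q) (hx : x ≠ 0) (d : ℤ)
    (h : |1 / x| - lam q * d ∈ Ico (α * lam q - lam q) (α * lam q)) : digit q α x = d := by
  have h1 : |1 / (x * lam q)| * lam q = |1 / x| := by
    rw [abs_div, abs_div, abs_mul, abs_of_pos hL]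
    have : |x| ≠ 0 := abs_ne_zero.mpr hx
    field_simp
  rw [digit, Int.floor_eq_iff]
  rw [← h1] at h
  obtain ⟨h2, h3⟩ := h
  constructor <;> nlinarith

/-! ### Invariance of the region, injectivity, contraction of fibres -/

namespace Staircase

variable {L t : ℝ} {M : ℕ} {c H : ℕ → ℝ}

theorem L_pos (S : Staircase L t M c H) : 0 < L := by linarith [S.le_L]

theorem t_pos (S : Staircase L t M c H) : 0 < t := by linarith [S.le_L, S.le_t]

theorem c_last_nonneg (S : Staircase L t M c H) : 0 ≤ c (M + 2) := by
  rcases S.gap with h | h <;> linarith [h.1]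

theorem H_le_one (S : Staircase L t M c H) {k : ℕ} (h1 : 1 ≤ k) (h2 : k ≤ M + 2) : H k ≤ 1 :=
  (S.H_mono k (M + 2) h1 h2 le_rfl).trans S.H_top.le

theorem c_one_neg (S : Staircase L t M c H) : c 1 < 0 := by
  rw [S.c_one]; linarith [S.le_L, S.t_le]

theorem snd_le_one (S : Staircase L t M c H) {z : ℝ × ℝ} (hz : z ∈ region t M c H) :
    z.2 ≤ 1 := by
  obtain ⟨-, -, -, k, h1, h2, -, h⟩ := hz
  exact h.trans (S.H_le_one h1 h2)

theorem snd_le_mid (S : Staircase L t M c H) {z : ℝ × ℝ} (hz : z ∈ region t M c H)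
    (h : z.1 < c (M + 2)) : z.2 ≤ L / 2 := by
  obtain ⟨-, -, -, k, h1, h2, h3, h4⟩ := hz
  have : k ≤ M + 1 := by
    by_contra hk
    obtain rfl : k = M + 2 := by omega
    linarith
  exact h4.trans ((S.H_mono k (M + 1) h1 this (by omega)).trans S.H_mid.le)

theorem snd_le_low (S : Staircase L t M c H) {z : ℝ × ℝ} (hz : z ∈ region t M c H)
    (h : z.1 < c (M + 1)) : z.2 ≤ L - 1 := by
  obtain ⟨-, -, -, k, h1, h2, h3, h4⟩ := hz
  have : k ≤ M := by
    by_contra hk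
    have := S.c_mono (M + 1) k (by omega) (by omega) h2
    linarith
  exact h4.trans ((S.H_mono k M h1 this (by omega)).trans S.H_low.le)

theorem one_div_abs_gt (S : Staircase L t M c H) {x : ℝ} (h1 : c 1 ≤ x) (h2 : x < t)
    (h0 : x ≠ 0) : t ≤ |1 / x| := by
  have hx : |x| ≤ 1 := by
    rw [abs_le]; rw [S.c_one] at h1
    constructor <;> linarith [S.le_t, S.t_le, S.L_lt]
  rw [abs_div, abs_one]
  exact S.t_le.trans (one_le_one_div (abs_pos.mpr h0) hx)

theorem one_le_digit {q : ℕ} {α : ℝ} (S : Staircase (lam q) (α * lam q) M c H) {x : ℝ}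
    (h1 : c 1 ≤ x) (h2 : x < α * lam q) (h0 : x ≠ 0) : 1 ≤ digit q α x := by
  have h := S.one_div_abs_gt h1 h2 h0
  rw [T_add (q := q) (α := α) h0] at h
  have h3 := (T_mem_Ico (α := α) S.L_pos h0).2
  have : 0 < lam q * digit q α x := by linarith
  have := (mul_pos_iff_of_pos_left S.L_pos).mp this
  exact_mod_cast this

/-- It suffices to exhibit one threshold left of the new point whose height bounds it. Digit one on
the negative side moves index k to k + 2, digit one on the positive side gives index 2, and larger
digits give index 1, except digit 2 just left of 0, which gives index 2. -/
theorem natMap_mem_region {q : ℕ} {α : ℝ} (S : Staircase (lam q) (α * lam q) M c H)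
    {z : ℝ × ℝ} (hz : z ∈ region (α * lam q) M c H) :
    natMap q α z ∈ region (α * lam q) M c H := by
  obtain ⟨x, y⟩ := z
  have hyone := S.snd_le_one hz
  have hmid := S.snd_le_mid hz
  have hlow := S.snd_le_low hz
  obtain ⟨h1, h2, hy, k, hk1, hk2, hck, hyk⟩ := hz
  simp only at *
  have hL := S.le_L
  have ht := S.t_pos
  have htle := S.t_le
  have hcl := S.c_last
  have hM := S.one_le
  have H2t : c 2 ≤ 0 ∧ 0 ≤ H 2 := by
    constructor
    · refine (S.c_mono 2 (M + 1) (by omega) (by omega) (by omega)).trans ?_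
      rcases S.gap with h | h
      · exact h.2.le
      · exact h.2.1.le
    · rw [S.H_two]; have := S.L_pos; positivity
  rcases eq_or_ne x 0 with rfl | hx
  · simp only [natMap, T, if_true]
    exact ⟨S.c_one_neg.le, ht, le_rfl, 2, by omega, by omega, H2t.1, H2t.2⟩
  obtain ⟨hT1, hT2⟩ := T_mem_Ico (α := α) S.L_pos hx
  have hd := S.one_le_digit h1 h2 hx
  have hTd := T_add (q := q) (α := α) hx
  simp only [natMap, if_neg hx]
  set L := lam q with hLdef
  set t := α * L with htdef
  set d := digit q α x with hddef
  set x' := T q α x with hx'def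
  have hd' : (1 : ℝ) ≤ d := by exact_mod_cast hd
  have hdL : L ≤ d * L := by nlinarith
  refine ⟨by rw [S.c_one]; exact hT1, hT2, ?_, ?_⟩
  · refine div_nonneg zero_le_one ?_
    rcases lt_or_gt_of_ne hx with h | h
    · rw [Real.sign_of_neg h]; linarith
    · rw [Real.sign_of_pos h]; linarith
  have hcases : d = 1 ∨ (2 ≤ d ∧ (2 : ℝ) * L ≤ d * L) := by
    rcases eq_or_ne d 1 with h | h
    · exact Or.inl h
    · right
      have h2d : (2 : ℤ) ≤ d := by omega
      have : (2 : ℝ) ≤ d := by exact_mod_cast h2d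
      exact ⟨h2d, by nlinarith⟩
  rcases lt_or_gt_of_ne hx with h | h
  · rw [Real.sign_of_neg h]
    have habs : |1 / x| = -1 / x := by
      rw [abs_of_neg (one_div_neg.mpr h)]; ring
    rw [habs] at hTd
    have hkM : k ≤ M + 1 := by
      by_contra hk
      obtain rfl : k = M + 2 := by omega
      linarith [S.c_last_nonneg]
    -- The gap relation bounds -1/x below by 1 / c (M + 2) + L ≥ 1 / t + L; if both thresholds
    -- vanish, no negative x lies here.
    have hfar : c (M + 1) ≤ x → 1 / t + L ≤ -1 / x := by
      intro hc
      rcases S.gap with hg | ⟨hg1, hg2, hg3⟩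
      · linarith [hg.2]
      · have e1 : -1 / c (M + 1) ≤ -1 / x := by
          rw [neg_div, neg_div, neg_le_neg_iff]
          exact one_div_le_one_div_of_neg_of_le h hc
        have e2 : 1 / t ≤ 1 / c (M + 2) := one_div_le_one_div_of_le hg1 hcl
        linarith
    have hmid' := hmid (by linarith [S.c_last_nonneg])
    rcases hcases with hd1 | ⟨h2d, hd2⟩
    -- With digit one, -1/x < t + L ≤ 1 + L contradicts `hfar`, so k = M + 1 is excluded and k + 2
    -- stays in range.
    · have hkM' : k ≤ M := by
        by_contra hk
        obtain rfl : k = M + 1 := by omega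
        have := hfar hck
        rw [hd1] at hTd
        have : 1 ≤ 1 / t := one_le_one_div ht htle
        push_cast at hTd
        linarith
      refine ⟨k + 2, by omega, by omega, ?_, ?_⟩
      · rw [S.c_step k hk1 hkM']
        have e1 : -1 / c k ≤ -1 / x := by
          rw [neg_div, neg_div, neg_le_neg_iff]
          exact one_div_le_one_div_of_neg_of_le h hck
        rw [hd1] at hTd
        push_cast at hTd
        linarith
      · rw [S.H_step k hk1 hkM', hd1]
        have := S.H_le_one hk1 hk2
        apply one_div_le_one_div_of_le <;> push_cast <;> linarith
    · by_cases hc : c (M + 1) ≤ x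
      · by_cases hd3 : d = 2
        · refine ⟨2, by omega, by omega, ?_, ?_⟩
          · have := hfar hc
            rw [S.c_two]
            rw [hd3] at hTd
            push_cast at hTd
            linarith
          · rw [S.H_two]
            apply one_div_le_one_div_of_le <;> linarith
        · have : (3 : ℤ) ≤ d := by omega
          have : (3 : ℝ) ≤ d := by exact_mod_cast this
          have : (3 : ℝ) * L ≤ d * L := by nlinarith
          refine ⟨1, by omega, by omega, ?_, ?_⟩
          · rw [S.c_one]; exact hT1
          · rw [S.H_one]
            apply one_div_le_one_div_of_le <;> linarith
      · have := hlow (not_le.mp hc)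
        refine ⟨1, by omega, by omega, ?_, ?_⟩
        · rw [S.c_one]; exact hT1
        · rw [S.H_one]
          apply one_div_le_one_div_of_le <;> linarith
  · rw [Real.sign_of_pos h]
    rw [abs_of_pos (one_div_pos.mpr h)] at hTd
    rcases hcases with hd1 | ⟨h2d, hd2⟩
    · refine ⟨2, by omega, by omega, ?_, ?_⟩
      · rw [hd1] at hTd
        have : 1 / t ≤ 1 / x := one_div_le_one_div_of_le h h2.le
        rw [S.c_two]
        push_cast at hTd
        linarith
      · rw [S.H_two]
        apply one_div_le_one_div_of_le <;> linarith
    · refine ⟨1, by omega, by omega, ?_, ?_⟩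
      · rw [S.c_one]; exact hT1
      · rw [S.H_one]
        apply one_div_le_one_div_of_le <;> linarith

theorem denom_pos {q : ℕ} {α : ℝ} (S : Staircase (lam q) (α * lam q) M c H)
    {z : ℝ × ℝ} (hz : z ∈ region (α * lam q) M c H) (h0 : z.1 ≠ 0) :
    0 < digit q α z.1 * lam q + Real.sign z.1 * z.2 := by
  have hd : (1 : ℝ) ≤ digit q α z.1 := by exact_mod_cast S.one_le_digit hz.1 hz.2.1 h0
  have h1 := S.snd_le_one hz
  have h2 := hz.2.2.1
  have hL := S.le_L
  rcases lt_or_gt_of_ne h0 with h | h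
  · rw [Real.sign_of_neg h]; nlinarith
  · rw [Real.sign_of_pos h]; nlinarith

/-- Points with the same image and opposite signs of the first coordinate do not exist
in the core. -/
theorem natMap_ne_of_sign {q : ℕ} {α : ℝ} (S : Staircase (lam q) (α * lam q) M c H)
    {z w : ℝ × ℝ} (hz : z ∈ core q α M c H) (hw : w ∈ core q α M c H)
    (hz0 : 0 < z.1) (hw0 : w.1 < 0) : natMap q α z ≠ natMap q α w := by
  intro h
  obtain ⟨hz, hz1, -, hz3, hz4, -, -⟩ := hz
  obtain ⟨hw, hw1, hw2, hw3, hw4, hw5, -⟩ := hw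
  have pz := S.denom_pos hz hz1
  have pw := S.denom_pos hw hw1
  have h1 : T q α z.1 = T q α w.1 := congrArg Prod.fst h
  have h2 := congrArg Prod.snd h
  simp only [natMap, if_neg hz1, if_neg hw1] at h2
  rw [one_div, one_div, inv_inj, Real.sign_of_pos hz0, Real.sign_of_neg hw0] at h2
  have ez := T_add (q := q) (α := α) hz1
  have ew := T_add (q := q) (α := α) hw1
  rw [abs_of_pos (one_div_pos.mpr hz0)] at ez
  rw [abs_of_neg (one_div_neg.mpr hw0)] at ew
  have yz := S.snd_le_one hz
  have yw := S.snd_le_one hw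
  have pz' : 0 < z.2 := lt_of_le_of_ne hz.2.2.1 (Ne.symm hz3)
  have pw' : 0 < w.2 := lt_of_le_of_ne hw.2.2.1 (Ne.symm hw3)
  have hL := S.le_L
  -- Equal second coordinates mean z.2 + w.2 = (d(w) - d(z)) L, and 0 < z.2 + w.2 ≤ 2 < 2L.
  have hd : digit q α w.1 = digit q α z.1 + 1 := by
    have a1 : (digit q α z.1 : ℝ) < digit q α w.1 := by
      by_contra hh
      nlinarith
    have a2 : (digit q α w.1 : ℝ) < digit q α z.1 + 2 := by
      by_contra hh
      nlinarith
    have a1' : digit q α z.1 < digit q α w.1 := by exact_mod_cast a1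
    have a2' : digit q α w.1 < digit q α z.1 + 2 := by exact_mod_cast a2
    omega
  rw [hd] at h2 ew
  push_cast at h2 ew
  have hsum : z.2 + w.2 = lam q := by linarith
  have hinv : -(1 / w.1) = 1 / z.1 + lam q := by rw [ez, ew, h1]; ring
  have wmid := S.snd_le_mid hw (by linarith [S.c_last_nonneg])
  -- Either both fibres have height at most L/2, or by the gap relation the heights are at most 1
  -- and L - 1. A sum equal to L then forces equality, on a line removed from the core.
  by_cases hc : z.1 < c (M + 2)
  · have := S.snd_le_mid hz hc
    exact hz4 (by linarith)
  · have hlow : w.1 < c (M + 1) := by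
      rcases S.gap with hg | ⟨hg1, hg2, hg3⟩
      · linarith [hg.2]
      · refine lt_of_le_of_ne ?_ hw2
        have e1 : 1 / z.1 ≤ 1 / c (M + 2) := one_div_le_one_div_of_le hg1 (not_lt.mp hc)
        have e2 : 1 / c (M + 1) ≤ 1 / w.1 := by
          rw [neg_div] at hg3; linarith
        exact (one_div_le_one_div_of_neg hg2 hw0).mp e2
    have := S.snd_le_low hw hlow
    exact hw5 (by linarith)

/-- For equal signs, (d - d')L equals a difference of two numbers in [0, 1], and L > 1 forces d =
d'; both coordinates are then recovered. -/
theorem injOn_natMap {q : ℕ} {α : ℝ} (S : Staircase (lam q) (α * lam q) M c H) :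
    InjOn (natMap q α) (core q α M c H) := by
  intro z hz w hw h
  have hsign : Real.sign z.1 = Real.sign w.1 := by
    rcases lt_or_gt_of_ne hz.2.1 with h1 | h1 <;> rcases lt_or_gt_of_ne hw.2.1 with h2 | h2
    · rw [Real.sign_of_neg h1, Real.sign_of_neg h2]
    · exact absurd h.symm (S.natMap_ne_of_sign hw hz h2 h1)
    · exact absurd h (S.natMap_ne_of_sign hz hw h1 h2)
    · rw [Real.sign_of_pos h1, Real.sign_of_pos h2]
  obtain ⟨hz, hz1, -⟩ := hz
  obtain ⟨hw, hw1, -⟩ := hw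
  have h1 : T q α z.1 = T q α w.1 := congrArg Prod.fst h
  have h2 := congrArg Prod.snd h
  simp only [natMap, if_neg hz1, if_neg hw1] at h2
  rw [one_div, one_div, inv_inj, ← hsign] at h2
  have hL := S.le_L
  have yz := S.snd_le_one hz
  have yw := S.snd_le_one hw
  have yz' := hz.2.2.1
  have yw' := hw.2.2.1
  have hs : Real.sign z.1 = -1 ∨ Real.sign z.1 = 1 := by
    rcases lt_or_gt_of_ne hz1 with h | h
    · exact Or.inl (Real.sign_of_neg h)
    · exact Or.inr (Real.sign_of_pos h)
  have hd : digit q α z.1 = digit q α w.1 := by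
    have a1 : (digit q α z.1 : ℝ) < digit q α w.1 + 1 := by
      by_contra hh
      rcases hs with hs | hs <;> rw [hs] at h2 <;> nlinarith
    have a2 : (digit q α w.1 : ℝ) < digit q α z.1 + 1 := by
      by_contra hh
      rcases hs with hs | hs <;> rw [hs] at h2 <;> nlinarith
    have a1' : digit q α z.1 < digit q α w.1 + 1 := by exact_mod_cast a1
    have a2' : digit q α w.1 < digit q α z.1 + 1 := by exact_mod_cast a2
    omega
  rw [hd] at h2
  have ez := T_add (q := q) (α := α) hz1
  rw [h1, hd, ← T_add hw1, abs_div, abs_div, abs_one, one_div, one_div, inv_inj] at ez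
  refine Prod.ext ?_ ?_
  · rcases abs_eq_abs.mp ez with h | h
    · exact h
    · rw [h, Real.sign_neg] at hsign
      rw [h, Real.sign_neg] at hs
      rcases hs with hs | hs <;> linarith
  · rcases hs with hs | hs <;> rw [hs] at h2 <;> linarith

/-- On two points of the region with the same first coordinate, the map `natMap` contracts the
second coordinate by the product of the new second coordinates. -/
theorem abs_snd_natMap_sub {q : ℕ} {α : ℝ} (S : Staircase (lam q) (α * lam q) M c H)
    {z w : ℝ × ℝ} (hz : z ∈ region (α * lam q) M c H) (hw : w ∈ region (α * lam q) M c H)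
    (h : z.1 = w.1) :
    |(natMap q α z).2 - (natMap q α w).2| =
      (natMap q α z).2 * (natMap q α w).2 * |z.2 - w.2| := by
  by_cases h0 : z.1 = 0
  · simp [natMap, h0, ← h]
  have h0' : w.1 ≠ 0 := h ▸ h0
  have pz := S.denom_pos hz h0
  have pw := S.denom_pos hw h0'
  simp only [natMap, if_neg h0, if_neg h0']
  rw [h] at *
  have hs : Real.sign w.1 = -1 ∨ Real.sign w.1 = 1 := by
    rcases lt_or_gt_of_ne h0' with h | h
    · exact Or.inl (Real.sign_of_neg h)
    · exact Or.inr (Real.sign_of_pos h)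
  have habs : |1 * (digit q α w.1 * lam q + Real.sign w.1 * w.2) -
      (digit q α w.1 * lam q + Real.sign w.1 * z.2) * 1| = |z.2 - w.2| := by
    rcases hs with hs | hs <;> rw [hs]
    · ring_nf
    · rw [abs_sub_comm]; ring_nf
  rw [div_sub_div _ _ pz.ne' pw.ne', abs_div, habs, abs_of_pos (mul_pos pz pw),
    div_mul_div_comm, one_mul, div_mul_eq_mul_div, one_mul]

theorem ratio_lt_one (S : Staircase L t M c H) : ratio L < 1 := by
  have := S.le_L
  refine max_lt (by linarith [S.L_lt]) ?_
  rw [div_lt_one] <;> linarith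

theorem ratio_pos (S : Staircase L t M c H) : 0 < ratio L :=
  lt_max_of_lt_left (half_pos S.L_pos)

/-- A single height can equal 1, so one step need not contract uniformly; a product of two
consecutive heights can be bounded. Left of c (M + 2) the first factor is at most L/2; right of it x
≥ 0 and the second factor is at most 1/L. -/
theorem snd_mul_snd_natMap_le {q : ℕ} {α : ℝ} (S : Staircase (lam q) (α * lam q) M c H)
    {z : ℝ × ℝ} (hz : z ∈ region (α * lam q) M c H) :
    z.2 * (natMap q α z).2 ≤ ratio (lam q) := by
  have hz' := S.natMap_mem_region hz
  have y1 := S.snd_le_one hz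
  have y2 := S.snd_le_one hz'
  have p1 := hz.2.2.1
  have p2 := hz'.2.2.1
  have hL := S.le_L
  by_cases h : z.1 < c (M + 2)
  · have := S.snd_le_mid hz h
    calc z.2 * (natMap q α z).2 ≤ lam q / 2 * 1 := by gcongr
      _ ≤ _ := by rw [mul_one]; exact le_max_left _ _
  · have h3 : (natMap q α z).2 ≤ 1 / lam q := by
      by_cases h0 : z.1 = 0
      · simp only [natMap, if_pos h0]
        have := S.L_pos
        positivity
      have hp : 0 < z.1 :=
        lt_of_le_of_ne (S.c_last_nonneg.trans (not_lt.mp h)) (Ne.symm h0)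
      have hd : (1 : ℝ) ≤ digit q α z.1 := by exact_mod_cast S.one_le_digit hz.1 hz.2.1 h0
      simp only [natMap, if_neg h0, Real.sign_of_pos hp]
      apply one_div_le_one_div_of_le <;> nlinarith
    calc z.2 * (natMap q α z).2 ≤ 1 * (1 / lam q) := by gcongr
      _ ≤ _ := by rw [one_mul]; exact le_max_right _ _

theorem iterate_mem_region {q : ℕ} {α : ℝ} (S : Staircase (lam q) (α * lam q) M c H)
    {z : ℝ × ℝ} (hz : z ∈ region (α * lam q) M c H) (n : ℕ) :
    (natMap q α)^[n] z ∈ region (α * lam q) M c H := by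
  induction n generalizing z with
  | zero => exact hz
  | succ n ih => exact ih (S.natMap_mem_region hz)

theorem fst_iterate_natMap (q : ℕ) (α : ℝ) (z : ℝ × ℝ) (n : ℕ) :
    ((natMap q α)^[n] z).1 = (T q α)^[n] z.1 := by
  induction n generalizing z with
  | zero => rfl
  | succ n ih => rw [Function.iterate_succ_apply, Function.iterate_succ_apply, ih]; rfl

/-- Two steps multiply the distance by a product of consecutive heights for z, at most `ratio`, and
one for w, at most 1. -/
theorem abs_snd_iterate_sub_le {q : ℕ} {α : ℝ} (S : Staircase (lam q) (α * lam q) M c H)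
    {z w : ℝ × ℝ} (hz : z ∈ region (α * lam q) M c H) (hw : w ∈ region (α * lam q) M c H)
    (h : z.1 = w.1) (n : ℕ) :
    |((natMap q α)^[2 * n] z).2 - ((natMap q α)^[2 * n] w).2| ≤ ratio (lam q) ^ n := by
  have key : ∀ {z w : ℝ × ℝ}, z ∈ region (α * lam q) M c H → w ∈ region (α * lam q) M c H →
      z.1 = w.1 → |(natMap q α (natMap q α z)).2 - (natMap q α (natMap q α w)).2| ≤
        ratio (lam q) * |z.2 - w.2| := by
    intro z w hz hw h
    have hz1 := S.natMap_mem_region hz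
    have hw1 := S.natMap_mem_region hw
    have hz2 := S.natMap_mem_region hz1
    have hw2 := S.natMap_mem_region hw1
    have h1 : (natMap q α z).1 = (natMap q α w).1 := congrArg (T q α) h
    rw [S.abs_snd_natMap_sub hz1 hw1 h1, S.abs_snd_natMap_sub hz hw h]
    have b1 := S.snd_mul_snd_natMap_le hz1
    have b2 := S.snd_le_one hw1
    have b3 := S.snd_le_one hw2
    have p0 := hz1.2.2.1
    have p1 := hz2.2.2.1
    have p2 := hw1.2.2.1
    have p3 := hw2.2.2.1
    have hr := S.ratio_pos
    calc _ = ((natMap q α z).2 * (natMap q α (natMap q α z)).2) *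
          ((natMap q α w).2 * (natMap q α (natMap q α w)).2) * |z.2 - w.2| := by ring
      _ ≤ (ratio (lam q) * (1 * 1)) * |z.2 - w.2| := by gcongr
      _ = _ := by ring
  induction n with
  | zero =>
    simp only [mul_zero, Function.iterate_zero, id, pow_zero]
    have := S.snd_le_one hz
    have := S.snd_le_one hw
    have := hz.2.2.1
    have := hw.2.2.1
    rw [abs_le]; constructor <;> linarith
  | succ n ih =>
    rw [show 2 * (n + 1) = (2 * n).succ.succ by omega]
    simp only [Function.iterate_succ_apply']
    refine (key (S.iterate_mem_region hz _) (S.iterate_mem_region hw _) ?_).trans ?_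
    · rw [fst_iterate_natMap, fst_iterate_natMap, h]
    · rw [pow_succ']
      exact mul_le_mul_of_nonneg_left ih S.ratio_pos.le

end Staircase

/-! ### From Borel sets to Lebesgue measurable sets -/

section Lift

variable {X : Type*} [mX : MeasurableSpace X] {v m : Measure X}
  {ρ : Measure (NullMeasurableSpace X v)}

/-- `ρ` is the extension of the Borel measure `m` to the `v`-measurable sets. -/
structure IsLift (v m : Measure X) (ρ : Measure (NullMeasurableSpace X v)) : Prop where
  apply : ∀ s : Set X, MeasurableSet s → ρ s = m s
  null : ∀ s : Set X, v s = 0 → ρ s = 0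

theorem IsLift.ae (h : IsLift v m ρ) {P : X → Prop} (hP : ∀ᵐ x ∂m, P x) :
    ∀ᵐ x ∂ρ, P x := by
  obtain ⟨t, ht1, ht2, ht3⟩ := exists_measurable_superset_of_null (ae_iff.mp hP)
  exact ae_iff.mpr (measure_mono_null ht1 ((h.apply t ht2).trans ht3))

/-- Borel measurability alone would not suffice: a completed set is Borel up to a null set, so
preimages of null sets must be null. -/
theorem measurable_lift {Y : Type*} [MeasurableSpace Y] {w : Measure Y} {f : X → Y}
    (hf : Measure.QuasiMeasurePreserving f v w) :
    Measurable (α := NullMeasurableSpace X v) (β := NullMeasurableSpace Y w) f :=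
  fun s hs => NullMeasurableSet.preimage (s := s) (μb := w) hs hf

theorem IsLift.ae_eq (h : IsLift v m ρ) {s t : Set X} (hst : s =ᵐ[v] t) : s =ᵐ[ρ] t :=
  mem_ae_iff.mpr (h.null _ (mem_ae_iff.mp hst))

theorem IsLift.measure_congr (h : IsLift v m ρ) {s t : Set X} (hst : s =ᵐ[v] t) :
    ρ s = ρ t := by
  exact MeasureTheory.measure_congr (h.ae_eq hst)

theorem IsLift.measurePreserving (h : IsLift v m ρ) {f : X → X}
    (hf : Measure.QuasiMeasurePreserving f v v) (hm : MeasurePreserving f m m) :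
    MeasurePreserving (α := NullMeasurableSpace X v) (β := NullMeasurableSpace X v) f ρ ρ := by
  refine MeasurePreserving.mk (measurable_lift hf)
    (Measure.ext (α := NullMeasurableSpace X v) fun s hs => ?_)
  refine (Measure.map_apply (measurable_lift hf) hs).trans ?_
  obtain ⟨t, -, ht, hst⟩ :=
    NullMeasurableSet.exists_measurable_superset_ae_eq (s := s) (μ := v) hs
  have e1 : ρ s = ρ t := h.measure_congr hst.symm
  have e2 : ρ (f ⁻¹' s) = ρ (f ⁻¹' t) := h.measure_congr (hf.preimage_ae_eq hst.symm)
  exact e2.trans ((h.apply _ (hf.measurable ht)).trans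
    ((hm.measure_preimage ht.nullMeasurableSet).trans ((h.apply _ ht).symm.trans e1.symm)))

end Lift

/-- An almost everywhere injective map that preserves the measure of images is invertible and
measure-preserving. -/
theorem exists_inverse {X : Type*} [MeasurableSpace X] [StandardBorelSpace X] {v m : Measure X}
    [IsFiniteMeasure m] {S : X → X} (hS : Measurable S) {K : Set X} (hK : MeasurableSet K)
    (hmK : m Kᶜ = 0) (hinj : InjOn S K)
    (himage : ∀ s ⊆ K, MeasurableSet s → m (S '' s) = m s)
    (hnull : ∀ s ⊆ K, v s = 0 → v (S '' s) = 0) :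
    MeasurePreserving S m m ∧ ∃ R : X → X, MeasurePreserving R m m ∧
      Measure.QuasiMeasurePreserving R v v ∧ (∀ᵐ x ∂m, R (S x) = x) ∧ (∀ᵐ x ∂m, S (R x) = x) := by
  have himg : ∀ s, MeasurableSet s → MeasurableSet (S '' (s ∩ K)) := fun s hs =>
    (hs.inter hK).image_of_measurable_injOn hS (hinj.mono inter_subset_right)
  have hSK : MeasurableSet (S '' K) := by simpa using himg univ MeasurableSet.univ
  have hinter : ∀ s, m (s ∩ K) = m s := fun s =>
    (congrArg m (inter_comm _ _)).trans <| Measure.measure_inter_eq_of_ae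
    (mem_ae_iff.mpr hmK)
  -- The image of K has the mass of K, which is the full finite mass, so nothing is left outside it.
  have hSKc : m (S '' K)ᶜ = 0 := by
    rw [measure_compl hSK (measure_ne_top _ _), himage K subset_rfl hK]
    have := hinter univ
    rw [univ_inter] at this
    rw [this, tsub_self]
  have hinter' : ∀ s, m (s ∩ S '' K) = m s := fun s =>
    (congrArg m (inter_comm _ _)).trans <| Measure.measure_inter_eq_of_ae
    (mem_ae_iff.mpr hSKc)
  have hpres : MeasurePreserving S m m := by
    refine ⟨hS, ?_⟩
    ext s hs
    rw [Measure.map_apply hS hs, ← hinter, ← himage _ inter_subset_right ((hS hs).inter hK),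
      ← hinter' s, image_preimage_inter]
  refine ⟨hpres, ?_⟩
  classical
  rcases isEmpty_or_nonempty X with hX | hX
  · exact ⟨id, MeasurePreserving.id m, Measure.QuasiMeasurePreserving.id v,
      Filter.Eventually.of_forall fun x => hX.elim x, Filter.Eventually.of_forall fun x => hX.elim x⟩
  -- Outside the image R is the identity, rather than a constant, so that v-null sets still have
  -- v-null preimages there.
  let R : X → X := fun x => if x ∈ S '' K then Function.invFunOn S K x else x
  have hRS : ∀ x ∈ K, R (S x) = x := fun x hx => by
    simp only [R, if_pos (mem_image_of_mem S hx)]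
    exact hinj.leftInvOn_invFunOn hx
  have hSR : ∀ x ∈ S '' K, S (R x) = x := by
    rintro _ ⟨x, hx, rfl⟩
    rw [hRS x hx]
  have hpre : ∀ s, R ⁻¹' s = S '' (s ∩ K) ∪ (s \ S '' K) := by
    intro s
    ext x
    by_cases hx : x ∈ S '' K
    · obtain ⟨y, hy, rfl⟩ := hx
      simp only [mem_preimage, hRS y hy, mem_union, mem_sdiff, mem_image_of_mem S hy, not_true,
        and_false, or_false]
      constructor
      · exact fun h => ⟨y, ⟨h, hy⟩, rfl⟩
      · rintro ⟨y', ⟨h1, h2⟩, h3⟩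
        rwa [← hinj h2 hy h3]
    · have hx' : x ∉ S '' (s ∩ K) := fun h => hx (image_mono inter_subset_right h)
      have hRx : R x = x := if_neg hx
      rw [mem_preimage, hRx, mem_union, mem_sdiff]
      exact ⟨fun h => Or.inr ⟨h, hx⟩, fun h => h.elim (fun h => absurd h hx') And.left⟩
  have hR : Measurable R := fun s hs => by
    rw [hpre]; exact (himg s hs).union (hs.diff hSK)
  refine ⟨R, ⟨hR, ?_⟩, ⟨hR, ?_⟩, ?_, ?_⟩
  · ext s hs
    rw [Measure.map_apply hR hs, hpre, ← hinter s,
      ← himage _ inter_subset_right (hs.inter hK)]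
    refine le_antisymm ((measure_union_le _ _).trans ?_) (measure_mono subset_union_left)
    have : m (s \ S '' K) = 0 := measure_mono_null (fun x hx => hx.2) hSKc
    rw [this, add_zero]
  · refine Measure.AbsolutelyContinuous.mk fun s hs hvs => ?_
    rw [Measure.map_apply hR hs, hpre]
    exact measure_union_null (hnull _ inter_subset_right (measure_mono_null inter_subset_left hvs))
      (measure_mono_null sdiff_subset hvs)
  · exact Filter.mem_of_superset (mem_ae_iff.mpr hmK) hRS
  · exact Filter.mem_of_superset (mem_ae_iff.mpr hSKc) hSR

/-! ### Invariant σ-algebras and the past -/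

section Generate

variable {X Y : Type*} {mX : MeasurableSpace X} {mY : MeasurableSpace Y} {ρ : Measure X}
  {S R : X → X} {π : X → Y}

theorem measurableSet_of_ae_eq {𝓒 : MeasurableSpace X} (h𝓒 : 𝓒 ∈ invariantSubalgebras (mX := mX) ρ S π)
    {A C : Set X} (hA : MeasurableSet[mX] A) (hC : MeasurableSet[𝓒] C) (hAC : A =ᵐ[ρ] C) :
    MeasurableSet[𝓒] A := by
  obtain ⟨hle, hnull, -⟩ := h𝓒
  have h1 : MeasurableSet[𝓒] (C \ A) :=
    hnull _ (@MeasurableSet.diff _ mX _ _ (hle _ hC) hA) (ae_le_set.mp hAC.symm.le)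
  have h2 : MeasurableSet[𝓒] (A \ C) := hnull _ (@MeasurableSet.diff _ mX _ _ hA (hle _ hC)) (ae_le_set.mp hAC.le)
  have : A = (C \ (C \ A)) ∪ (A \ C) := by
    rw [sdiff_sdiff_right_self, inter_comm, inter_union_sdiff]
  rw [this]
  exact @MeasurableSet.union _ 𝓒 _ _ (@MeasurableSet.diff _ 𝓒 _ _ hC h1) h2

/-- Invariance is stated for S only. For C in 𝓒, the set S⁻¹(R⁻¹C) equals C almost everywhere, hence
lies in 𝓒, and invariance then puts R⁻¹C in 𝓒. -/
theorem measurable_iterate_inverse {𝓒 : MeasurableSpace X}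
    (h𝓒 : 𝓒 ∈ invariantSubalgebras (mX := mX) ρ S π) (hS : Measurable[mX, mX] S) (hR : Measurable[mX, mX] R)
    (hRS : ∀ᵐ x ∂ρ, R (S x) = x) (n : ℕ) : Measurable[𝓒, mY] (fun x => π (R^[n] x)) := by
  have step : Measurable[𝓒, 𝓒] R := by
    intro C hC
    have hC' := h𝓒.1 _ hC
    refine (h𝓒.2.2.2 _ (hR hC')).mp (measurableSet_of_ae_eq h𝓒 (hS (hR hC')) hC ?_)
    filter_upwards [hRS] with x hx
    exact propext (by change R (S x) ∈ C ↔ x ∈ C; rw [hx])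
  have hπ : Measurable[𝓒, mY] π := fun B hB => h𝓒.2.2.1 B hB
  exact @Measurable.comp _ _ _ 𝓒 𝓒 mY _ _ hπ (@Measurable.iterate _ 𝓒 _ step n)

/-- A real function that is an almost everywhere limit of `𝓒`-measurable functions is
`𝓒`-measurable. -/
theorem measurable_of_tendsto_of_mem_invariantSubalgebras {𝓒 : MeasurableSpace X}
    (h𝓒 : 𝓒 ∈ invariantSubalgebras (mX := mX) ρ S π) {f : ℕ → X → ℝ} {g : X → ℝ}
    (hf : ∀ n, Measurable[𝓒] (f n)) (hg : Measurable[mX] g)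
    (hlim : ∀ᵐ x ∂ρ, Filter.Tendsto (fun n => f n x) Filter.atTop (nhds (g x))) :
    Measurable[𝓒] g := by
  -- The limsup is 𝓒-measurable with no convergence assumption, and it equals g almost everywhere.
  have hG : Measurable[𝓒] (fun x => Filter.limsup (fun n => f n x) Filter.atTop) :=
    Measurable.limsup hf
  intro B hB
  refine measurableSet_of_ae_eq h𝓒 (hg hB) (hG hB) ?_
  filter_upwards [hlim] with x hx
  refine propext ?_
  change g x ∈ B ↔ Filter.limsup (fun n => f n x) Filter.atTop ∈ B
  rw [hx.limsup_eq]

end Generate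

/-! ### Measurability and null sets -/

theorem measurable_digit (q : ℕ) (α : ℝ) : Measurable (digit q α) := by
  unfold digit
  exact Int.measurable_floor.comp (by fun_prop)

theorem measurable_T (q : ℕ) (α : ℝ) : Measurable (T q α) := by
  unfold T
  refine Measurable.ite (measurableSet_singleton 0) measurable_const ?_
  have := measurable_digit q α
  have h : Measurable fun x => ((digit q α x : ℤ) : ℝ) := by fun_prop
  fun_prop

theorem measurable_sign : Measurable Real.sign := by
  unfold Real.sign
  exact Measurable.ite measurableSet_Iio measurable_const
    (Measurable.ite measurableSet_Ioi measurable_const measurable_const)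

theorem measurable_natMap (q : ℕ) (α : ℝ) : Measurable (natMap q α) := by
  unfold natMap
  refine ((measurable_T q α).comp measurable_fst).prodMk ?_
  refine Measurable.ite (measurable_fst (measurableSet_singleton 0)) measurable_const ?_
  have h1 : Measurable fun x : ℝ × ℝ => digit q α x.1 := (measurable_digit q α).comp measurable_fst
  have h2 : Measurable fun x : ℝ × ℝ => Real.sign x.1 := measurable_sign.comp measurable_fst
  have h : Measurable fun x : ℝ × ℝ => ((digit q α x.1 : ℤ) : ℝ) :=
    (measurable_of_countable (fun n : ℤ => (n : ℝ))).comp h1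
  fun_prop

theorem quasiMeasurePreserving_inv :
    Measure.QuasiMeasurePreserving (fun x : ℝ => x⁻¹) volume volume := by
  refine ⟨measurable_inv, Measure.AbsolutelyContinuous.mk fun s hs h0 => ?_⟩
  rw [Measure.map_apply measurable_inv hs]
  have h1 : volume ((fun x : ℝ => x⁻¹) '' (s \ {0})) = 0 := by
    refine addHaar_image_eq_zero_of_differentiableOn_of_addHaar_eq_zero volume ?_
      (measure_mono_null sdiff_subset h0)
    exact fun x hx => (differentiableAt_inv hx.2).differentiableWithinAt
  refine measure_mono_null (t := (fun x : ℝ => x⁻¹) '' (s \ {0}) ∪ {0}) ?_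
    (measure_union_null h1 (measure_singleton 0))
  intro x hx
  by_cases h : x = 0
  · exact Or.inr h
  · exact Or.inl ⟨x⁻¹, ⟨hx, inv_ne_zero h⟩, inv_inv x⟩

theorem quasiMeasurePreserving_affine {a : ℝ} (ha : a ≠ 0) (b : ℝ) :
    Measure.QuasiMeasurePreserving (fun x : ℝ => a * x + b) volume volume := by
  have h1 : Measure.QuasiMeasurePreserving (fun x : ℝ => a * x) volume volume := by
    refine ⟨by fun_prop, ?_⟩
    rw [Real.map_volume_mul_left ha]
    exact Measure.smul_absolutelyContinuous
  exact (measurePreserving_add_right volume b).quasiMeasurePreserving.comp h1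

/-- The branch of `natMap` with sign `s` and digit `d`. -/
def branch (L s : ℝ) (d : ℤ) : ℝ × ℝ → ℝ × ℝ :=
  Prod.map (fun x => s * x⁻¹ - L * d) (fun y => (s * y + d * L)⁻¹)

theorem quasiMeasurePreserving_branch_fst (L : ℝ) {s : ℝ} (hs : s ≠ 0) (d : ℤ) :
    Measure.QuasiMeasurePreserving (fun x : ℝ => s * x⁻¹ - L * d) volume volume :=
  (quasiMeasurePreserving_affine hs (-(L * d))).comp quasiMeasurePreserving_inv

theorem quasiMeasurePreserving_branch (L : ℝ) {s : ℝ} (hs : s ≠ 0) (d : ℤ) :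
    Measure.QuasiMeasurePreserving (branch L s d) volume volume :=
  QuasiMeasurePreserving.prodMap (quasiMeasurePreserving_branch_fst L hs d)
    (quasiMeasurePreserving_inv.comp (quasiMeasurePreserving_affine hs (d * L)))

theorem T_eq_branch {q : ℕ} {α x : ℝ} (hx : x ≠ 0) :
    T q α x = Real.sign x * x⁻¹ - lam q * digit q α x := by
  rw [T, if_neg hx]
  congr 1
  rcases lt_or_gt_of_ne hx with h | h
  · rw [Real.sign_of_neg h, abs_of_neg (one_div_neg.mpr h)]; ring
  · rw [Real.sign_of_pos h, abs_of_pos (one_div_pos.mpr h)]; ring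

theorem natMap_eq_branch {q : ℕ} {α : ℝ} {z : ℝ × ℝ} (hx : z.1 ≠ 0) :
    natMap q α z = branch (lam q) (Real.sign z.1) (digit q α z.1) z := by
  refine Prod.ext (T_eq_branch hx) ?_
  simp only [natMap, if_neg hx, branch, Prod.map]
  rw [one_div, add_comm]

theorem sign_eq_units {x : ℝ} (hx : x ≠ 0) : ∃ s : ℤˣ, Real.sign x = s := by
  rcases lt_or_gt_of_ne hx with h | h
  · exact ⟨-1, by simp [Real.sign_of_neg h]⟩
  · exact ⟨1, by simp [Real.sign_of_pos h]⟩

theorem units_cast_ne_zero (s : ℤˣ) : ((s : ℤ) : ℝ) ≠ 0 := by exact_mod_cast s.ne_zero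

/-- Away from 0 the preimage of a null set is covered by its preimages under countably many
branches, one for each sign and digit, and each branch pulls null sets back to null sets. -/
theorem quasiMeasurePreserving_T (q : ℕ) (α : ℝ) :
    Measure.QuasiMeasurePreserving (T q α) volume volume := by
  refine ⟨measurable_T q α, Measure.AbsolutelyContinuous.mk fun N hN h0 => ?_⟩
  rw [Measure.map_apply (measurable_T q α) hN]
  refine measure_mono_null (t := {0} ∪ ⋃ s : ℤˣ, ⋃ d : ℤ,
    (fun x : ℝ => ((s : ℤ) : ℝ) * x⁻¹ - lam q * d) ⁻¹' N) ?_
    (measure_union_null (measure_singleton 0) (measure_iUnion_null fun s =>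
      measure_iUnion_null fun d =>
        (quasiMeasurePreserving_branch_fst _ (units_cast_ne_zero s) d).preimage_null h0))
  intro x hx
  by_cases h : x = 0
  · exact Or.inl h
  · obtain ⟨s, hs⟩ := sign_eq_units h
    rw [mem_preimage, T_eq_branch h, hs] at hx
    exact Or.inr (mem_iUnion₂.mpr ⟨s, _, hx⟩)

theorem volume_fst_eq (a : ℝ) : volume {z : ℝ × ℝ | z.1 = a} = 0 :=
  (Measure.quasiMeasurePreserving_fst (μ := volume) (ν := volume)).preimage_null
    (measure_singleton a)

theorem volume_snd_eq (a : ℝ) : volume {z : ℝ × ℝ | z.2 = a} = 0 :=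
  (Measure.quasiMeasurePreserving_snd (μ := volume) (ν := volume)).preimage_null
    (measure_singleton a)

theorem quasiMeasurePreserving_natMap (q : ℕ) (α : ℝ) :
    Measure.QuasiMeasurePreserving (natMap q α) volume volume := by
  refine ⟨measurable_natMap q α, Measure.AbsolutelyContinuous.mk fun N hN h0 => ?_⟩
  rw [Measure.map_apply (measurable_natMap q α) hN]
  refine measure_mono_null (t := {z | z.1 = 0} ∪ ⋃ s : ℤˣ, ⋃ d : ℤ,
    branch (lam q) (s : ℤ) d ⁻¹' N) ?_
    (measure_union_null (volume_fst_eq 0) (measure_iUnion_null fun s =>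
      measure_iUnion_null fun d =>
        (quasiMeasurePreserving_branch _ (units_cast_ne_zero s) d).preimage_null h0))
  intro z hz
  by_cases h : z.1 = 0
  · exact Or.inl h
  · obtain ⟨s, hs⟩ := sign_eq_units h
    rw [mem_preimage, natMap_eq_branch h, hs] at hz
    exact Or.inr (mem_iUnion₂.mpr ⟨s, _, hz⟩)

/-! ### The derivative of the natural extension map -/

theorem eventually_digit_eq {q : ℕ} {α x : ℝ} (hL : lam q ≠ 0) (hx : x ≠ 0)
    (h : ∀ n : ℤ, |1 / (x * lam q)| + 1 - α ≠ n) : ∀ᶠ u in nhds x, digit q α u = digit q α x := by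
  have hc : ContinuousAt (fun u : ℝ => |1 / (u * lam q)| + 1 - α) x := by
    refine ((ContinuousAt.abs ?_).add continuousAt_const).sub continuousAt_const
    exact continuousAt_const.div (by fun_prop) (mul_ne_zero hx hL)
  have h1 : (digit q α x : ℝ) < |1 / (x * lam q)| + 1 - α :=
    lt_of_le_of_ne (Int.floor_le _) (Ne.symm (h _))
  have h2 := Int.lt_floor_add_one (|1 / (x * lam q)| + 1 - α)
  filter_upwards [hc.eventually (Ioo_mem_nhds h1 h2)] with u hu
  exact Int.floor_eq_iff.mpr ⟨hu.1.le, hu.2⟩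

theorem eventually_sign_eq {x : ℝ} (hx : x ≠ 0) : ∀ᶠ u in nhds x, Real.sign u = Real.sign x := by
  rcases lt_or_gt_of_ne hx with h | h
  · filter_upwards [Iio_mem_nhds h] with u hu
    rw [Real.sign_of_neg h, Real.sign_of_neg hu]
  · filter_upwards [Ioi_mem_nhds h] with u hu
    rw [Real.sign_of_pos h, Real.sign_of_pos hu]

/-- The derivative of `branch L s d` at `z`. -/
def branchDeriv (L s : ℝ) (d : ℤ) (z : ℝ × ℝ) : ℝ × ℝ →L[ℝ] ℝ × ℝ :=
  (ContinuousLinearMap.toSpanSingleton ℝ (s * -(z.1 ^ 2)⁻¹)).prodMap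
    (ContinuousLinearMap.toSpanSingleton ℝ (-s / (s * z.2 + d * L) ^ 2))

theorem hasFDerivAt_branch {L s : ℝ} {d : ℤ} {z : ℝ × ℝ} (hx : z.1 ≠ 0)
    (hy : s * z.2 + d * L ≠ 0) : HasFDerivAt (branch L s d) (branchDeriv L s d z) z := by
  refine HasFDerivAt.prodMap z ?_ ?_
  · exact (((hasDerivAt_inv hx).const_mul s).sub_const _).hasFDerivAt
  · have := (((hasDerivAt_id z.2).const_mul s).add_const (d * L)).inv hy
    simp only [mul_one] at this
    exact this.hasFDerivAt

theorem det_branchDeriv (L s : ℝ) (d : ℤ) (z : ℝ × ℝ) :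
    (branchDeriv L s d z).det = (s * -(z.1 ^ 2)⁻¹) * (-s / (s * z.2 + d * L) ^ 2) := by
  rw [ContinuousLinearMap.det, branchDeriv, ContinuousLinearMap.coe_prodMap, LinearMap.det_prodMap]
  simp [LinearMap.det_ring]

theorem hasFDerivAt_natMap {q : ℕ} {α : ℝ} (hL : lam q ≠ 0) {z : ℝ × ℝ} (hx : z.1 ≠ 0)
    (hy : Real.sign z.1 * z.2 + digit q α z.1 * lam q ≠ 0)
    (h : ∀ n : ℤ, |1 / (z.1 * lam q)| + 1 - α ≠ n) :
    HasFDerivAt (natMap q α) (branchDeriv (lam q) (Real.sign z.1) (digit q α z.1) z) z := by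
  refine (hasFDerivAt_branch hx hy).congr_of_eventuallyEq ?_
  have hf : Filter.Tendsto Prod.fst (nhds z) (nhds z.1) := continuous_fst.tendsto z
  filter_upwards [hf.eventually (eventually_digit_eq hL hx h), hf.eventually (eventually_sign_eq hx),
    hf.eventually (isOpen_ne.mem_nhds hx)] with w h1 h2 h3
  rw [natMap_eq_branch h3, h1, h2]

/-- With D = s y + d L, the determinant is 1/(xD)², while 1 + x'y' = s(1 + xy)/(xD); the factors
(xD)² cancel. -/
theorem abs_det_mul_density {L s : ℝ} {d : ℤ} {z : ℝ × ℝ} (hs : s ^ 2 = 1) (hx : z.1 ≠ 0)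
    (hy : s * z.2 + d * L ≠ 0) (h : 1 + z.1 * z.2 ≠ 0) (C : ℝ) :
    |(branchDeriv L s d z).det| * (C / (1 + (branch L s d z).1 * (branch L s d z).2) ^ 2) =
      C / (1 + z.1 * z.2) ^ 2 := by
  have e1 : (branchDeriv L s d z).det = 1 / (z.1 * (s * z.2 + d * L)) ^ 2 := by
    rw [det_branchDeriv]
    field_simp
    linear_combination hs
  have e2 : 1 + (branch L s d z).1 * (branch L s d z).2 =
      s * (1 + z.1 * z.2) / (z.1 * (s * z.2 + d * L)) := by
    simp only [branch, Prod.map]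
    rw [eq_div_iff (mul_ne_zero hx hy)]
    linear_combination (s * z.1⁻¹ - L * d) * z.1 * inv_mul_cancel₀ hy + s * inv_mul_cancel₀ hx
  have hs0 : s ≠ 0 := by rintro rfl; norm_num at hs
  rw [e1, e2, abs_of_nonneg (by positivity), div_pow, mul_pow s, hs]
  field_simp

theorem measurableSet_region (t : ℝ) (M : ℕ) (c H : ℕ → ℝ) : MeasurableSet (region t M c H) := by
  have : region t M c H = {z : ℝ × ℝ | c 1 ≤ z.1} ∩ {z | z.1 < t} ∩ {z | 0 ≤ z.2} ∩
      ⋃ k ∈ Icc 1 (M + 2), {z | c k ≤ z.1} ∩ {z | z.2 ≤ H k} := by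
    ext z
    simp only [region, mem_ofPred_eq, mem_inter_iff, mem_iUnion, mem_Icc, exists_prop, and_assoc]
  rw [this]
  refine (((measurableSet_le measurable_const measurable_fst).inter
    (measurableSet_lt measurable_fst measurable_const)).inter
    (measurableSet_le measurable_const measurable_snd)).inter
    (MeasurableSet.biUnion (to_countable _) fun k _ => ?_)
  exact (measurableSet_le measurable_const measurable_fst).inter
    (measurableSet_le measurable_snd measurable_const)

/-- The density of `ν_α`. -/
def density (p : ℕ) (α : ℝ) (z : ℝ × ℝ) : ENNReal :=
  ENNReal.ofReal (normConst p α / (1 + z.1 * z.2) ^ 2)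

theorem measurable_density (p : ℕ) (α : ℝ) : Measurable (density p α) := by
  unfold density
  fun_prop

/-- The restriction of `ν_α` to the Borel sets. -/
def borelNu (p : ℕ) (α : ℝ) : Measure (ℝ × ℝ) :=
  (volume.restrict (Omega p α)).withDensity (density p α)

theorem measurePreserving_completion {X : Type*} [MeasurableSpace X] (v : Measure X) :
    MeasurePreserving (α := NullMeasurableSpace X v) (β := X) id v.completion v := by
  have h : Measurable[NullMeasurableSpace.instMeasurableSpace (μ := v)] (id : X → X) :=
    fun s hs => hs.nullMeasurableSet
  refine ⟨h, Measure.ext fun s hs => ?_⟩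
  exact (Measure.map_apply h hs).trans (Measure.completion_apply v s)

theorem isLift_nu {p : ℕ} {α : ℝ} (hΩ : MeasurableSet (Omega p α)) :
    IsLift volume (borelNu p α) (nu p α) := by
  have hid := measurePreserving_completion (volume : Measure (ℝ × ℝ))
  refine ⟨fun s hs => ?_, fun s hs => ?_⟩
  · have h1 := (hid.restrict_preimage hΩ).restrict_preimage hs
    have h2 := h1.lintegral_comp (measurable_density p α)
    refine (withDensity_apply (α := LebesguePlane) _ (hid.measurable hs)).trans (Eq.trans h2 ?_)
    exact (withDensity_apply _ hs).symm
  · refine withDensity_absolutelyContinuous (α := LebesguePlane) _ _ ?_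
    exact Measure.absolutelyContinuous_of_le Measure.restrict_le_self hs

/-! ### The invariant measure and the natural extension -/

namespace Staircase

variable {L t : ℝ} {M : ℕ} {c H : ℕ → ℝ} {p q : ℕ} {α : ℝ}

theorem one_add_mul_ge (S : Staircase L t M c H) {z : ℝ × ℝ} (hz : z ∈ region t M c H) :
    1 - L / 2 ≤ 1 + z.1 * z.2 := by
  have h1 := hz.1
  have h2 := S.snd_le_one hz
  have h3 := hz.2.2.1
  have h4 := S.le_t
  have h5 := S.L_pos
  rw [S.c_one] at h1
  nlinarith

theorem one_add_mul_pos (S : Staircase L t M c H) {z : ℝ × ℝ} (hz : z ∈ region t M c H) :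
    0 < 1 + z.1 * z.2 := by
  linarith [S.one_add_mul_ge hz, S.L_lt]

theorem volume_region_lt_top (S : Staircase L t M c H) : volume (region t M c H) < ⊤ := by
  refine (measure_mono (t := Icc (-1) 1 ×ˢ Icc 0 1) ?_).trans_lt
    (isCompact_Icc.prod isCompact_Icc).measure_lt_top
  intro z hz
  have h1 := hz.1
  rw [S.c_one] at h1
  exact ⟨⟨by linarith [S.L_lt, S.le_t], hz.2.1.le.trans S.t_le⟩, hz.2.2.1, S.snd_le_one hz⟩

theorem volume_region_pos (S : Staircase L t M c H) : 0 < volume (region t M c H) := by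
  refine lt_of_lt_of_le ?_ (measure_mono (s := Ico (c 1) t ×ˢ Icc 0 (H 1)) ?_)
  · rw [Measure.volume_eq_prod, Measure.prod_prod, Real.volume_Ico, Real.volume_Icc, S.c_one,
      S.H_one]
    have := S.L_pos
    refine ENNReal.mul_pos ?_ ?_ <;> simp only [ne_eq, ENNReal.ofReal_eq_zero, not_le]
    · linarith
    · rw [sub_zero]; positivity
  · rintro z ⟨⟨h1, h2⟩, h3, h4⟩
    exact ⟨h1, h2, h3, 1, le_rfl, by omega, h1, h4⟩

theorem integrableOn_density (S : Staircase L t M c H) :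
    IntegrableOn (fun z : ℝ × ℝ => 1 / (1 + z.1 * z.2) ^ 2) (region t M c H) := by
  refine IntegrableOn.of_bound (C := 1 / (1 - L / 2) ^ 2) S.volume_region_lt_top ?_ ?_
  · exact Measurable.aestronglyMeasurable (by fun_prop)
  · refine (ae_restrict_iff' (measurableSet_region t M c H)).mpr (Filter.Eventually.of_forall ?_)
    intro z hz
    have h1 := S.one_add_mul_ge hz
    have h2 : 0 < 1 - L / 2 := by linarith [S.L_lt]
    rw [Real.norm_of_nonneg (by positivity)]
    gcongr

theorem integral_density_pos (S : Staircase L t M c H) :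
    0 < ∫ z in region t M c H, 1 / (1 + z.1 * z.2) ^ 2 := by
  rw [setIntegral_pos_iff_support_of_nonneg_ae
    (Filter.Eventually.of_forall fun z => by positivity) S.integrableOn_density]
  refine S.volume_region_pos.trans_le (measure_mono fun z hz => ⟨?_, hz⟩)
  have := S.one_add_mul_pos hz
  exact ne_of_gt (by positivity)

theorem normConst_pos (S : Staircase L t M c H) (hΩ : Omega p α = region t M c H) :
    0 < normConst p α := by
  rw [normConst, hΩ]
  exact inv_pos.mpr S.integral_density_pos

theorem isProbabilityMeasure_borelNu (S : Staircase L t M c H)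
    (hΩ : Omega p α = region t M c H) : IsProbabilityMeasure (borelNu p α) := by
  refine ⟨?_⟩
  have h0 := S.normConst_pos hΩ
  rw [borelNu, withDensity_apply _ MeasurableSet.univ, Measure.restrict_univ]
  unfold density
  rw [hΩ, ← ofReal_integral_eq_lintegral_ofReal]
  · have : ∀ z : ℝ × ℝ, normConst p α / (1 + z.1 * z.2) ^ 2 =
        normConst p α * (1 / (1 + z.1 * z.2) ^ 2) := fun z => by ring
    simp_rw [this]
    rw [integral_const_mul, normConst, hΩ, inv_mul_cancel₀ S.integral_density_pos.ne',
      ENNReal.ofReal_one]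
  · have := S.integrableOn_density.const_mul (normConst p α)
    simpa only [IntegrableOn, mul_one_div] using this
  · exact Filter.Eventually.of_forall fun z => by positivity

theorem region_diff_core (S : Staircase (lam q) (α * lam q) M c H) :
    volume (region (α * lam q) M c H \ core q α M c H) = 0 := by
  have hcount : (⋃ n : ℤ, {x : ℝ | |1 / (x * lam q)| + 1 - α = n}).Countable := by
    refine countable_iUnion fun n => ?_
    refine (Set.Finite.subset (s := {1 / ((n - 1 + α) * lam q), -(1 / ((n - 1 + α) * lam q))})
      (by simp) ?_).countable
    intro x hx
    have hx' : |1 / (x * lam q)| = n - 1 + α := by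
      have : |1 / (x * lam q)| + 1 - α = n := hx
      linarith
    have hL := S.L_pos.ne'
    rcases eq_or_ne x 0 with rfl | h0
    -- Since 1/0 = 0, the point x = 0 satisfies the equation only when n - 1 + α = 0, and then the
    -- listed solution is also 1/0 = 0.
    · rw [zero_mul, div_zero, abs_zero] at hx'
      rw [← hx']; simp
    rcases abs_cases (1 / (x * lam q)) with h | h <;> rw [h.1] at hx' <;> rw [← hx']
    · left; field_simp
    · right
      rw [mem_singleton_iff]
      field_simp
  have h1 : volume (Prod.fst ⁻¹' (⋃ n : ℤ, {x : ℝ | |1 / (x * lam q)| + 1 - α = n}) :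
      Set (ℝ × ℝ)) = 0 :=
    (Measure.quasiMeasurePreserving_fst (μ := volume) (ν := volume)).preimage_null
      (hcount.measure_zero volume)
  refine measure_mono_null ?_ (measure_union_null (volume_fst_eq 0) (measure_union_null
    (volume_fst_eq (c (M + 1))) (measure_union_null (volume_snd_eq 0) (measure_union_null
    (volume_snd_eq (lam q / 2)) (measure_union_null (volume_snd_eq (lam q - 1)) h1)))))
  rintro z ⟨hz, hz'⟩
  by_contra h
  simp only [mem_union, not_or, mem_preimage, mem_iUnion, not_exists, mem_ofPred_eq] at h
  exact hz' ⟨hz, h⟩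

theorem measurableSet_core (q : ℕ) (α : ℝ) (M : ℕ) (c H : ℕ → ℝ) :
    MeasurableSet (core q α M c H) := by
  have h : ∀ n : ℤ, MeasurableSet {z : ℝ × ℝ | |1 / (z.1 * lam q)| + 1 - α = n} := fun n =>
    measurableSet_eq_fun (by fun_prop) measurable_const
  have e : core q α M c H = region (α * lam q) M c H ∩ {z | z.1 = 0}ᶜ ∩ {z | z.1 = c (M + 1)}ᶜ ∩
      {z | z.2 = 0}ᶜ ∩ {z | z.2 = lam q / 2}ᶜ ∩ {z | z.2 = lam q - 1}ᶜ ∩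
      ⋂ n : ℤ, {z : ℝ × ℝ | |1 / (z.1 * lam q)| + 1 - α = n}ᶜ := by
    ext z
    simp only [core, mem_ofPred_eq, mem_inter_iff, mem_compl_iff, mem_iInter, and_assoc, ne_eq]
  rw [e]
  refine ((((((measurableSet_region _ _ _ _).inter ?_).inter ?_).inter ?_).inter ?_).inter ?_).inter
    (MeasurableSet.iInter fun n => (h n).compl)
  all_goals exact (measurableSet_eq_fun (by fun_prop) measurable_const).compl

theorem hasFDerivAt_of_mem_core (S : Staircase (lam q) (α * lam q) M c H) {z : ℝ × ℝ}
    (hz : z ∈ core q α M c H) : HasFDerivAt (natMap q α)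
      (branchDeriv (lam q) (Real.sign z.1) (digit q α z.1) z) z := by
  refine hasFDerivAt_natMap S.L_pos.ne' hz.2.1 ?_ hz.2.2.2.2.2.2
  rw [add_comm]
  exact (S.denom_pos hz.1 hz.2.1).ne'

theorem borelNu_image (S : Staircase (lam q) (α * lam q) M c H)
    (hΩ : Omega p α = region (α * lam q) M c H) {s : Set (ℝ × ℝ)} (hs : s ⊆ core q α M c H)
    (hms : MeasurableSet s) : borelNu p α (natMap q α '' s) = borelNu p α s := by
  have hinj := S.injOn_natMap.mono hs
  have himg := hms.image_of_measurable_injOn (measurable_natMap q α) hinj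
  have hsub : natMap q α '' s ⊆ Omega p α := by
    rw [hΩ]
    exact image_subset_iff.mpr fun z hz => S.natMap_mem_region (hs hz).1
  have hsub' : s ⊆ Omega p α := by rw [hΩ]; exact fun z hz => (hs hz).1
  have e : ∀ u, MeasurableSet u → u ⊆ Omega p α → borelNu p α u = ∫⁻ z in u, density p α z := by
    intro u hu hu'
    rw [borelNu, withDensity_apply _ hu, Measure.restrict_restrict hu, inter_eq_left.mpr hu']
  rw [e _ himg hsub, e _ hms hsub', lintegral_image_eq_lintegral_abs_det_fderiv_mul volume hms
    (fun z hz => (S.hasFDerivAt_of_mem_core (hs hz)).hasFDerivWithinAt) hinj]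
  refine setLIntegral_congr_fun hms fun z hz => ?_
  have hz' := hs hz
  obtain ⟨u, hu⟩ := sign_eq_units hz'.2.1
  have hsq : Real.sign z.1 ^ 2 = 1 := by
    rcases Int.units_eq_one_or u with h | h <;> rw [hu, h] <;> norm_num
  have hd := (S.denom_pos hz'.1 hz'.2.1).ne'
  rw [add_comm] at hd
  simp only [density]
  rw [← ENNReal.ofReal_mul (abs_nonneg _), natMap_eq_branch hz'.2.1,
    abs_det_mul_density hsq hz'.2.1 hd (S.one_add_mul_pos hz'.1).ne']

theorem volume_image_eq_zero (S : Staircase (lam q) (α * lam q) M c H) {s : Set (ℝ × ℝ)}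
    (hs : s ⊆ core q α M c H) (h0 : volume s = 0) : volume (natMap q α '' s) = 0 :=
  addHaar_image_eq_zero_of_differentiableOn_of_addHaar_eq_zero volume
    (fun _ hz => (S.hasFDerivAt_of_mem_core (hs hz)).differentiableAt.differentiableWithinAt) h0

theorem borelNu_compl_core (S : Staircase (lam q) (α * lam q) M c H)
    (hΩ : Omega p α = region (α * lam q) M c H) : borelNu p α (core q α M c H)ᶜ = 0 := by
  refine withDensity_absolutelyContinuous _ _ ?_
  rw [Measure.restrict_apply (measurableSet_core q α M c H).compl, hΩ, inter_comm, ← sdiff_eq]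
  exact S.region_diff_core

theorem mapsTo_T (S : Staircase (lam q) (α * lam q) M c H) : MapsTo (T q α) (I q α) (I q α) := by
  intro x hx
  by_cases h0 : x = 0
  · rw [T, if_pos h0, ← h0]; exact hx
  · have := T_mem_Ico (α := α) S.L_pos h0
    exact ⟨by linarith [this.1], this.2.le⟩

/-- The second coordinate is almost everywhere determined by the first coordinates of the past. -/
theorem tendsto_snd_past (S : Staircase (lam q) (α * lam q) M c H) {m : Measure (ℝ × ℝ)}
    {R : ℝ × ℝ → ℝ × ℝ} (hm : ∀ᵐ z ∂m, z ∈ region (α * lam q) M c H)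
    (hR : MeasurePreserving R m m) (hSR : ∀ᵐ z ∂m, natMap q α (R z) = z) :
    ∀ᵐ z ∂m, Filter.Tendsto (fun n => ((natMap q α)^[2 * n] ((R^[2 * n] z).1, 0)).2)
      Filter.atTop (nhds z.2) := by
  have h1 : ∀ᵐ z ∂m, ∀ n, R^[n] z ∈ region (α * lam q) M c H :=
    ae_all_iff.mpr fun n => (hR.iterate n).quasiMeasurePreserving.ae hm
  have h2 : ∀ᵐ z ∂m, ∀ n, natMap q α (R (R^[n] z)) = R^[n] z :=
    ae_all_iff.mpr fun n => (hR.iterate n).quasiMeasurePreserving.ae hSR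
  filter_upwards [h1, h2] with z h1 h2
  have h3 : ∀ n, (natMap q α)^[n] (R^[n] z) = z := by
    intro n
    induction n with
    | zero => rfl
    | succ n ih => rw [Function.iterate_succ_apply' R, Function.iterate_succ_apply, h2, ih]
  rw [tendsto_iff_dist_tendsto_zero]
  refine squeeze_zero (fun _ => dist_nonneg) (fun n => ?_)
    (tendsto_pow_atTop_nhds_zero_of_lt_one S.ratio_pos.le S.ratio_lt_one)
  have hz := h1 (2 * n)
  -- Fibres of the region start at 0, so the unknown second coordinate of the past point may be
  -- replaced by 0; 2n steps forward erase the error.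
  have hz0 : ((R^[2 * n] z).1, (0 : ℝ)) ∈ region (α * lam q) M c H := by
    obtain ⟨a1, a2, a3, k, a4, a5, a6, a7⟩ := hz
    exact ⟨a1, a2, le_rfl, k, a4, a5, a6, a3.trans a7⟩
  have := S.abs_snd_iterate_sub_le hz0 hz rfl n
  rwa [h3] at this

theorem isNaturalExtension (S : Staircase (lam q) (α * lam q) M c H)
    (hΩ : Omega p α = region (α * lam q) M c H) :
    IsNaturalExtension (X := LebesguePlane) (Y := LebesgueLine) (Omega p α) (nu p α) (natMap q α)
      (I q α) (mu p α) (T q α) proj := by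
  have hΩm : MeasurableSet (Omega p α) := by rw [hΩ]; exact measurableSet_region _ _ _ _
  have hlift := isLift_nu hΩm
  have hprob := S.isProbabilityMeasure_borelNu hΩ
  have hcore := S.borelNu_compl_core hΩ
  obtain ⟨hpres, R, hR, hRq, hRS, hSR⟩ := exists_inverse (v := volume) (measurable_natMap q α)
    (measurableSet_core q α M c H) hcore S.injOn_natMap (fun s hs hms => S.borelNu_image hΩ hs hms)
    (fun s hs h0 => S.volume_image_eq_zero hs h0)
  have hSν := hlift.measurePreserving (quasiMeasurePreserving_natMap q α) hpres
  have hRν := hlift.measurePreserving hRq hR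
  have hνprob : IsProbabilityMeasure (nu p α) :=
    ⟨(hlift.apply univ MeasurableSet.univ).trans hprob.measure_univ⟩
  have hΩae : ∀ᵐ z ∂borelNu p α, z ∈ region (α * lam q) M c H :=
    Filter.mem_of_superset (mem_ae_iff.mpr hcore) fun z hz => hz.1
  have hproj : MeasurePreserving proj (nu p α) (mu p α) :=
    (measurable_lift (Measure.quasiMeasurePreserving_fst
      (μ := (volume : Measure ℝ)) (ν := (volume : Measure ℝ)))).measurePreserving _
  have hIcc : @MeasurableSet LebesgueLine _ (I q α) :=
    (measurableSet_Icc (a := lam q * (α - 1)) (b := α * lam q)).nullMeasurableSet (μ := volume)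
  have hmaps : MapsTo proj (Omega p α) (I q α) := by
    intro z hz
    rw [hΩ] at hz
    have h1 := hz.1
    rw [S.c_one] at h1
    exact ⟨by change _ ≤ z.1; linarith, hz.2.1.le⟩
  have hcompl : nu p α (Omega p α)ᶜ = 0 :=
    (hlift.apply _ hΩm.compl).trans (by rw [hΩ]; exact mem_ae_iff.mp hΩae)
  have hTm := measurable_lift (quasiMeasurePreserving_T q α)
  refine ⟨⟨hνprob, hΩm.nullMeasurableSet, hcompl, ?_, hSν⟩, ⟨R, hRν, hlift.ae hRS, hlift.ae hSR⟩,
    ⟨⟨(hproj.measure_preimage MeasurableSet.univ.nullMeasurableSet).symm.trans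
      hνprob.measure_univ⟩, hIcc, ?_, S.mapsTo_T, MeasurePreserving.mk hTm
      ((Measure.map_map (μ := nu p α) hTm hproj.measurable).trans (hproj.comp hSν).map_eq)⟩, hmaps, hproj,
    Filter.Eventually.of_forall fun z => rfl, ⟨⟨le_rfl, fun N hN _ => hN,
      fun B hB => hproj.measurable hB, fun A hA => ⟨fun _ => hA, fun _ => hSν.measurable hA⟩⟩, ?_⟩⟩
  · rw [hΩ]
    exact fun z hz => S.natMap_mem_region hz
  · refine (hproj.measure_preimage hIcc.compl.nullMeasurableSet).symm.trans ?_
    exact measure_mono_null (fun z hz h => hz (hmaps h)) hcompl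
  · have hSm := hSν.measurable
    have hRm := hRν.measurable
    have hline : @Measurable LebesgueLine ℝ _ _ id :=
      (measurePreserving_completion (volume : Measure ℝ)).measurable
    have hplane : @Measurable LebesguePlane (ℝ × ℝ) _ _ id :=
      (measurePreserving_completion (volume : Measure (ℝ × ℝ))).measurable
    intro 𝓒 h𝓒
    have hiter : ∀ n, Measurable[𝓒] (fun z : ℝ × ℝ => (R^[n] z).1) := fun n =>
      @Measurable.comp _ _ _ 𝓒 _ _ _ (fun z => proj (R^[n] z)) hline
        (measurable_iterate_inverse h𝓒 hSm hRm (hlift.ae hRS) n)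
    have happrox : ∀ n, Measurable fun x : ℝ => ((natMap q α)^[2 * n] (x, 0)).2 := fun n =>
      measurable_snd.comp (((measurable_natMap q α).iterate (2 * n)).comp (by fun_prop))
    have hsnd : Measurable[𝓒] (Prod.snd : ℝ × ℝ → ℝ) :=
      measurable_of_tendsto_of_mem_invariantSubalgebras h𝓒
        (f := fun n z => ((natMap q α)^[2 * n] ((R^[2 * n] z).1, 0)).2)
        (fun n => @Measurable.comp _ _ _ 𝓒 _ _
          (fun x : ℝ => ((natMap q α)^[2 * n] (x, 0)).2) _ (happrox n) (hiter (2 * n)))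
        (@Measurable.comp LebesguePlane _ _ _ _ _ _ _ measurable_snd hplane)
        (hlift.ae (S.tendsto_snd_past hΩae hR hSR))
    -- Both coordinates being 𝓒-measurable, every Borel set lies in 𝓒; Lebesgue measurable sets
    -- follow since 𝓒 contains the null sets.
    have hid : Measurable[𝓒] (id : ℝ × ℝ → ℝ × ℝ) := Measurable.prodMk (hiter 0) hsnd
    intro A hA
    obtain ⟨B, -, hB, hAB⟩ :=
      NullMeasurableSet.exists_measurable_superset_ae_eq (s := A)
        (μ := (volume : Measure (ℝ × ℝ))) hA
    exact measurableSet_of_ae_eq h𝓒 hA (hid hB) (hlift.ae_eq hAB.symm)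

end Staircase

/-! ### The numbers `B_n` -/

section BNumbers

variable {p : ℕ}

theorem sin_pi_div_pos (hp : 2 ≤ p) : 0 < Real.sin (Real.pi / (2 * p : ℕ)) := by
  have h : (4 : ℝ) ≤ (2 * p : ℕ) := by exact_mod_cast (by omega : 4 ≤ 2 * p)
  refine Real.sin_pos_of_pos_of_lt_pi (by have := Real.pi_pos; positivity) ?_
  exact div_lt_self Real.pi_pos (by linarith)

theorem B_rec (q : ℕ) (n : ℤ) : B q (n + 1) = lam q * B q n - B q (n - 1) := by
  have h := Real.sin_add (n * Real.pi / q) (Real.pi / q)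
  have h' := Real.sin_sub (n * Real.pi / q) (Real.pi / q)
  have e1 : ((n + 1 : ℤ) : ℝ) * Real.pi / q = n * Real.pi / q + Real.pi / q := by push_cast; ring
  have e2 : ((n - 1 : ℤ) : ℝ) * Real.pi / q = n * Real.pi / q - Real.pi / q := by push_cast; ring
  simp only [B, lam, e1, e2, h, h']
  ring

theorem B_zero (q : ℕ) : B q 0 = 0 := by simp [B]

theorem B_one (hp : 2 ≤ p) : B (2 * p) 1 = 1 := by
  simp only [B, Int.cast_one, one_mul]
  exact div_self (sin_pi_div_pos hp).ne'

theorem B_neg_one (hp : 2 ≤ p) : B (2 * p) (-1) = -1 := by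
  have := B_rec (2 * p) 0
  rw [zero_add, zero_sub, B_one hp, B_zero] at this
  linarith

theorem B_two (hp : 2 ≤ p) : B (2 * p) 2 = lam (2 * p) := by
  have := B_rec (2 * p) 1
  rw [B_one hp, sub_self, B_zero] at this
  rw [show (2 : ℤ) = 1 + 1 by norm_num, this]; ring

/-- The angles kπ/(2p) with |k| ≤ p lie in [-π/2, π/2], where the sine increases. -/
theorem B_lt_B (hp : 2 ≤ p) {j k : ℤ} (h1 : -p ≤ j) (h2 : j < k) (h3 : k ≤ p) :
    B (2 * p) j < B (2 * p) k := by
  refine div_lt_div_of_pos_right ?_ (sin_pi_div_pos hp)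
  have hp' : (0 : ℝ) < p := by exact_mod_cast (by omega : 0 < p)
  have hπ := Real.pi_pos
  have h1' : -(p : ℝ) ≤ j := by exact_mod_cast h1
  have h2' : (j : ℝ) < k := by exact_mod_cast h2
  have h3' : (k : ℝ) ≤ p := by exact_mod_cast h3
  refine Real.sin_lt_sin_of_lt_of_le_pi_div_two ?_ ?_ ?_
  · rw [← neg_div, div_le_div_iff₀ two_pos (by positivity)]
    push_cast; nlinarith
  · rw [div_le_div_iff₀ (by positivity) two_pos]
    push_cast; nlinarith
  · gcongr

theorem B_pos (hp : 2 ≤ p) {k : ℤ} (h1 : 0 < k) (h2 : k ≤ p) : 0 < B (2 * p) k := by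
  have := B_lt_B hp (j := 0) (by omega) h1 h2
  rwa [B_zero] at this

theorem B_nonneg (hp : 2 ≤ p) {k : ℤ} (h1 : 0 ≤ k) (h2 : k ≤ p) : 0 ≤ B (2 * p) k := by
  rcases h1.eq_or_lt with h | h
  · rw [← h, B_zero]
  · exact (B_pos hp h h2).le

/-- Index p corresponds to the angle π/2, about which the sine is symmetric; this is where q even
enters. -/
theorem B_succ_eq_B_pred (hp : 2 ≤ p) : B (2 * p) (p + 1) = B (2 * p) (p - 1) := by
  have hp' : (p : ℝ) ≠ 0 := by exact_mod_cast (by omega : p ≠ 0)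
  have e1 : ((p + 1 : ℤ) : ℝ) * Real.pi / (2 * p : ℕ) =
      Real.pi / 2 + Real.pi / (2 * p : ℕ) := by push_cast; field_simp
  have e2 : ((p - 1 : ℤ) : ℝ) * Real.pi / (2 * p : ℕ) =
      Real.pi / 2 - Real.pi / (2 * p : ℕ) := by push_cast; field_simp
  simp only [B, e1, e2, Real.sin_pi_div_two_sub]
  rw [add_comm, Real.sin_add_pi_div_two]

theorem two_mul_B_pred (hp : 2 ≤ p) :
    2 * B (2 * p) (p - 1) = lam (2 * p) * B (2 * p) p := by
  have := B_rec (2 * p) p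
  rw [B_succ_eq_B_pred hp] at this
  linarith

theorem lam_lt_two (hp : 2 ≤ p) : lam (2 * p) < 2 := by
  have h1 := B_pos hp (k := p) (by omega) le_rfl
  have h2 := B_lt_B hp (j := p - 1) (k := p) (by omega) (by omega) le_rfl
  have h3 := two_mul_B_pred hp
  by_contra h
  nlinarith

theorem le_lam (hp : 2 ≤ p) : 7 / 5 ≤ lam (2 * p) := by
  have hp' : (4 : ℝ) ≤ (2 * p : ℕ) := by exact_mod_cast (by omega : 4 ≤ 2 * p)
  have h : Real.cos (Real.pi / 4) ≤ Real.cos (Real.pi / (2 * p : ℕ)) := by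
    refine Real.cos_le_cos_of_nonneg_of_le_pi (by have := Real.pi_pos; positivity) ?_ ?_
    · linarith [Real.pi_pos]
    · exact div_le_div_of_nonneg_left Real.pi_pos.le (by norm_num) hp'
  rw [Real.cos_pi_div_four] at h
  have : (7 / 5 : ℝ) ≤ √2 := Real.le_sqrt_of_sq_le (by norm_num)
  unfold lam
  linarith

end BNumbers

/-! ### Thresholds and heights -/

/-- The orbits of the endpoints under `x ↦ -1 / x - L`, interlaced. -/
def threshold (L t : ℝ) : ℕ → ℝ
  -- Since 1/t - L = -1/(-t) - L, starting at -t lets one recursion also produce the orbit of the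
  -- right endpoint.
  | 0 => -t
  | 1 => t - L
  | (k + 2) => -1 / threshold L t k - L

/-- The sequence of heights `H_n`. -/
def height (L : ℝ) : ℕ → ℝ
  -- A fictitious height 0 makes the recursion give H_2 = 1/L.
  | 0 => 0
  | 1 => 1 / (L + 1)
  | (k + 2) => 1 / (L - height L k)

section Sequences

variable {p : ℕ} {t : ℝ}

theorem even_num_neg (hp : 2 ≤ p) (ht : lam (2 * p) / 2 ≤ t) {n : ℕ} (hn : n + 2 ≤ p) :
    B (2 * p) n - B (2 * p) (n + 1) * t < 0 := by
  have h1 := B_lt_B hp (j := n) (k := n + 2) (by omega) (by omega) (by omega)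
  have h2 := B_pos hp (k := n + 1) (by omega) (by omega)
  have h3 := B_rec (2 * p) (n + 1)
  rw [add_sub_cancel_right, add_assoc, one_add_one_eq_two] at h3
  nlinarith

theorem even_denom_pos (hp : 2 ≤ p) (ht : lam (2 * p) / 2 ≤ t) {n : ℕ} (hn : n + 1 ≤ p) :
    0 < B (2 * p) n * t - B (2 * p) (n - 1) := by
  have h1 := B_lt_B hp (j := n - 1) (k := n + 1) (by omega) (by omega) (by omega)
  have h2 := B_nonneg hp (k := n) (by omega) (by omega)
  have h3 := B_rec (2 * p) n
  nlinarith

theorem odd_num_neg (hp : 2 ≤ p) (ht : t ≤ 1) {n : ℕ} (hn : n + 2 ≤ p) :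
    B (2 * p) (n + 1) * t - B (2 * p) (n + 2) < 0 := by
  have h1 := B_lt_B hp (j := n + 1) (k := n + 2) (by omega) (by omega) (by omega)
  have h2 := B_pos hp (k := n + 1) (by omega) (by omega)
  nlinarith

theorem odd_denom_pos (hp : 2 ≤ p) (ht : t ≤ 1) {n : ℕ} (hn : n + 1 ≤ p) :
    0 < B (2 * p) (n + 1) - B (2 * p) n * t := by
  have h1 := B_lt_B hp (j := n) (k := n + 1) (by omega) (by omega) (by omega)
  have h2 := B_nonneg hp (k := n) (by omega) (by omega)
  nlinarith

/-- The branch sends N/D to (D + LN)/(-N), so numerators and denominators follow the recurrence of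
B_n. -/
theorem threshold_even (hp : 2 ≤ p) (ht : lam (2 * p) / 2 ≤ t) {n : ℕ} (hn : n + 1 ≤ p) :
    threshold (lam (2 * p)) t (2 * n) =
      (B (2 * p) n - B (2 * p) (n + 1) * t) / (B (2 * p) n * t - B (2 * p) (n - 1)) := by
  induction n with
  | zero =>
    simp only [threshold, Nat.cast_zero, zero_add, zero_sub, B_zero, B_one hp,
      B_neg_one hp]
    ring
  | succ n ih =>
    have h1 := even_num_neg hp ht (n := n) (by omega)
    have h2 := even_denom_pos hp ht (n := n) (by omega)
    have h3 := even_denom_pos hp ht (n := n + 1) hn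
    have r1 := B_rec (2 * p) n
    have r2 := B_rec (2 * p) (n + 1)
    rw [mul_add, mul_one, threshold, ih (by omega)]
    push_cast at h3 ⊢
    rw [add_sub_cancel_right] at h3 r2 ⊢
    rw [neg_div, one_div_div, r2, ← neg_sub (B (2 * p) (n + 1) * t), div_neg, neg_neg,
      div_sub' h3.ne']
    congr 1
    linear_combination -r1

theorem threshold_odd (hp : 2 ≤ p) (ht : t ≤ 1) {n : ℕ} (hn : n + 1 ≤ p) :
    threshold (lam (2 * p)) t (2 * n + 1) =
      (B (2 * p) (n + 1) * t - B (2 * p) (n + 2)) / (B (2 * p) (n + 1) - B (2 * p) n * t) := by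
  induction n with
  | zero =>
    simp only [zero_add, threshold, Nat.cast_zero, B_zero, B_one hp, B_two hp]
    ring
  | succ n ih =>
    have h1 := odd_num_neg hp ht (n := n) (by omega)
    have h2 := odd_denom_pos hp ht (n := n) (by omega)
    have h3 := odd_denom_pos hp ht (n := n + 1) hn
    have r1 := B_rec (2 * p) (n + 1)
    have r2 := B_rec (2 * p) (n + 2)
    rw [show 2 * (n + 1) + 1 = 2 * n + 1 + 2 by ring, threshold, ih (by omega)]
    push_cast at h3 ⊢
    have e1 : (n : ℤ) + 1 + 1 = n + 2 := by ring
    have e2 : (n : ℤ) + 1 + 2 = n + 2 + 1 := by ring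
    have e3 : (n : ℤ) + 2 - 1 = n + 1 := by ring
    rw [e1] at h3 r1 ⊢
    rw [e3] at r2
    rw [add_sub_cancel_right] at r1
    rw [e2, neg_div, one_div_div, r2]
    have h1' := h1.ne
    have h3' := h3.ne'
    field_simp
    rw [r1]
    ring

theorem height_even (hp : 2 ≤ p) {n : ℕ} (hn : n + 1 ≤ p) :
    height (lam (2 * p)) (2 * n) = HEven p n := by
  unfold HEven
  induction n with
  | zero => simp [height, B_zero]
  | succ n ih =>
    have h1 := B_pos hp (k := n + 1) (by omega) (by omega)
    have h2 := B_pos hp (k := n + 1 + 1) (by omega) (by omega)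
    have r := B_rec (2 * p) (n + 1)
    rw [add_sub_cancel_right] at r
    rw [mul_add, mul_one, height, ih (by omega)]
    push_cast
    rw [r] at h2 ⊢
    rw [sub_div' h1.ne', one_div_div]

theorem height_odd (hp : 2 ≤ p) {n : ℕ} (hn : n + 1 ≤ p) :
    height (lam (2 * p)) (2 * n + 1) = HOdd p (n + 1) := by
  unfold HOdd
  induction n with
  | zero =>
    have h1 := B_lt_B hp (j := p - 1 - 1) (k := p - 1) (by omega) (by omega) (by omega)
    have r := B_rec (2 * p) (p - 1)
    have r' := two_mul_B_pred hp
    have hL := le_lam hp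
    rw [sub_add_cancel] at r
    simp only [zero_add, height]
    push_cast
    rw [add_sub_cancel_right]
    rw [div_eq_div_iff (by linarith) (by linarith)]
    linear_combination r - r'
  | succ n ih =>
    have h1 := B_lt_B hp (j := p - 1 - (n + 1)) (k := p - (n + 1))
      (by omega) (by omega) (by omega)
    have r1 := B_rec (2 * p) (p - (n + 1))
    have r2 := B_rec (2 * p) (p - 1 - (n + 1))
    rw [show 2 * (n + 1) + 1 = 2 * n + 1 + 2 by ring, height, ih (by omega)]
    push_cast
    have e1 : (p : ℤ) - (n + 1 + 1) = p - 1 - (n + 1) := by ring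
    have e2 : (p : ℤ) + 1 - (n + 1 + 1) = p - (n + 1) := by ring
    have e3 : (p : ℤ) - 1 - (n + 1 + 1) = p - 1 - (n + 1) - 1 := by ring
    have e4 : (p : ℤ) - 1 - (n + 1) + 1 = p - (n + 1) := by ring
    have e5 : (p : ℤ) - (n + 1) + 1 = p + 1 - (n + 1) := by ring
    have e6 : (p : ℤ) - (n + 1) - 1 = p - 1 - (n + 1) := by ring
    rw [e1, e2, e3]
    rw [e4] at r2
    rw [e5, e6] at r1
    rw [sub_div' (by linarith), one_div_div]
    congr 1
    linear_combination r1 - r2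

theorem height_le_one (hp : 2 ≤ p) {k : ℕ} (hk : k + 1 ≤ 2 * p) :
    height (lam (2 * p)) k ≤ 1 := by
  obtain ⟨n, rfl | rfl⟩ := Nat.even_or_odd' k
  · rw [height_even hp (by omega), HEven]
    have h1 := B_lt_B hp (j := n) (k := n + 1) (by omega) (by omega) (by omega)
    have h2 := B_pos hp (k := n + 1) (by omega) (by omega)
    exact (div_le_one h2).mpr h1.le
  · rw [height_odd hp (by omega), HOdd]
    push_cast
    have h1 := B_lt_B hp (j := p - 1 - (n + 1)) (k := p - (n + 1))
      (by omega) (by omega) (by omega)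
    have r := B_rec (2 * p) (p - (n + 1))
    have h2 := B_nonneg hp (k := p - (n + 1)) (by omega) (by omega)
    have e5 : (p : ℤ) - (n + 1) + 1 = p + 1 - (n + 1) := by ring
    have e6 : (p : ℤ) - (n + 1) - 1 = p - 1 - (n + 1) := by ring
    rw [e5, e6] at r
    have hL := lam_lt_two hp
    rw [div_le_one_of_neg (by linarith)]
    nlinarith

theorem height_le_succ (hp : 2 ≤ p) {k : ℕ} (hk : k + 2 ≤ 2 * p) :
    height (lam (2 * p)) k ≤ height (lam (2 * p)) (k + 1) := by
  have hL := le_lam hp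
  induction k using Nat.twoStepInduction with
  | zero => simp only [height]; positivity
  | one =>
    simp only [height, sub_zero]
    exact one_div_le_one_div_of_le (by linarith) (by linarith)
  | more k ih _ =>
    rw [height, height]
    have := height_le_one hp (k := k + 1) (by omega)
    exact one_div_le_one_div_of_le (by linarith) (by linarith [ih (by omega)])

theorem threshold_neg (hp : 2 ≤ p) (ht : lam (2 * p) / 2 ≤ t) (ht' : t ≤ 1) {k : ℕ}
    (hk : k + 3 ≤ 2 * p) : threshold (lam (2 * p)) t k < 0 := by
  obtain ⟨n, rfl | rfl⟩ := Nat.even_or_odd' k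
  · rw [threshold_even hp ht (by omega)]
    exact div_neg_of_neg_of_pos (even_num_neg hp ht (by omega)) (even_denom_pos hp ht (by omega))
  · rw [threshold_odd hp ht' (by omega)]
    exact div_neg_of_neg_of_pos (odd_num_neg hp ht' (by omega)) (odd_denom_pos hp ht' (by omega))

/-- The map x ↦ -1/x - L is increasing on negative numbers, so the order passes from k to k + 2; it
starts from -t ≤ t - L ≤ 1/t - L. -/
theorem threshold_le_succ (hp : 2 ≤ p) (ht : lam (2 * p) / 2 ≤ t) (ht' : t ≤ 1) {k : ℕ}
    (hk : k + 2 ≤ 2 * p) : threshold (lam (2 * p)) t k ≤ threshold (lam (2 * p)) t (k + 1) := by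
  have hL := le_lam hp
  induction k using Nat.twoStepInduction with
  | zero => simp only [threshold]; linarith
  | one =>
    simp only [threshold]
    have : 1 ≤ 1 / t := one_le_one_div (by linarith) ht'
    rw [neg_div_neg_eq]
    linarith
  | more k ih _ =>
    rw [threshold, threshold]
    have := threshold_neg hp ht ht' (k := k + 1) (by omega)
    have := one_div_le_one_div_of_neg_of_le this (ih (by omega))
    rw [neg_div, neg_div]
    linarith

theorem le_of_le_succ_of_le {f : ℕ → ℝ} {N : ℕ} (h : ∀ k, 1 ≤ k → k + 1 ≤ N → f k ≤ f (k + 1))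
    (j k : ℕ) (hj : 1 ≤ j) (hjk : j ≤ k) (hk : k ≤ N) : f j ≤ f k := by
  induction k, hjk using Nat.le_induction with
  | base => exact le_rfl
  | succ k hjk ih => exact (ih (by omega)).trans (h k (by omega) hk)

/-- Here M = 2p - 3, so the 2p - 1 pieces are indexed up to M + 2; setting p = m + 2 avoids natural
subtraction. -/
theorem isStaircase {m : ℕ} (hm : p = m + 2) (ht : lam (2 * p) / 2 ≤ t) (ht' : t ≤ 1) :
    Staircase (lam (2 * p)) t (2 * m + 1) (threshold (lam (2 * p)) t) (height (lam (2 * p))) := by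
  have hp : 2 ≤ p := by omega
  have hL := le_lam hp
  have hb := B_pos hp (k := p) (by omega) le_rfl
  have ha := two_mul_B_pred hp
  have he : (p : ℤ) - 1 = (m + 1 : ℕ) := by push_cast; omega
  have hmid := threshold_even hp ht (n := m + 1) (by omega)
  have hlast := threshold_odd hp ht' (n := m + 1) (by omega)
  have dmid := even_denom_pos hp ht (n := m + 1) (by omega)
  have dlast := odd_denom_pos hp ht' (n := m + 1) (by omega)
  have e1 : ((m + 1 : ℕ) : ℤ) + 1 = p := by push_cast; omega
  have e2 : ((m + 1 : ℕ) : ℤ) + 2 = p + 1 := by push_cast; omega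
  have r := B_rec (2 * p) (p - 1)
  rw [sub_add_cancel, he] at r
  rw [e1, e2, B_succ_eq_B_pred hp, he] at hlast
  rw [e1] at hmid dlast
  rw [he] at ha
  refine ⟨hL, lam_lt_two hp, ht, ht', by omega, rfl, ?_, fun k _ _ => rfl,
    fun k _ hk => threshold_neg hp ht ht' (by omega),
    le_of_le_succ_of_le fun k _ hk => threshold_le_succ hp ht ht' (by omega), ?_, ?_, rfl, ?_,
    fun k _ _ => rfl, le_of_le_succ_of_le fun k _ hk => height_le_succ hp (by omega), ?_, ?_, ?_⟩
  · simp only [threshold, neg_div_neg_eq]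
  · rw [show 2 * m + 1 + 2 = 2 * (m + 1) + 1 by ring, hlast, div_le_iff₀ dlast]
    -- With a = B_{p-1} and b = B_p, the claim (bt - a)/(b - at) ≤ t reduces to a t² ≤ a.
    have : t ^ 2 ≤ 1 := by nlinarith
    have ha0 := B_nonneg hp (k := (m + 1 : ℕ)) (by omega) (by omega)
    nlinarith [mul_nonneg ha0 (sub_nonneg.mpr this)]
  · rw [show 2 * m + 1 + 2 = 2 * (m + 1) + 1 by ring, show 2 * m + 1 + 1 = 2 * (m + 1) by ring,
      hmid, hlast]
    -- The relation 2 B_{p-1} = λ B_p makes both numerators vanish exactly at t = λ/2.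
    rcases ht.eq_or_lt with h | h
    · left
      have : B (2 * p) p * t - B (2 * p) (m + 1 : ℕ) = 0 := by
        rw [← h]; linear_combination -ha / 2
      rw [this, ← neg_sub (B (2 * p) p * t), this]
      simp
    · right
      have hpos : 0 < B (2 * p) p * t - B (2 * p) (m + 1 : ℕ) := by nlinarith
      refine ⟨div_pos hpos dlast, div_neg_of_neg_of_pos (by linarith) dmid, ?_⟩
      rw [neg_div, one_div_div, one_div_div, ← neg_sub (B (2 * p) p * t), div_neg, neg_neg,
        div_add' _ _ _ hpos.ne']
      congr 1
      linear_combination t * ha - r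
  · simp only [height, sub_zero]
  · rw [height_odd hp (by omega), HOdd]
    have e : (p : ℤ) = m + 2 := by omega
    push_cast
    rw [e, show (m : ℤ) + 2 - (m + 1) = 1 by ring, show (m : ℤ) + 2 + 1 - (m + 1) = 2 by ring,
      show (m : ℤ) + 2 - 1 - (m + 1) = 0 by ring, B_one hp, B_two hp, B_zero]
    ring
  · rw [show 2 * m + 1 + 1 = 2 * (m + 1) by ring, height_even hp (by omega), HEven, e1,
      div_eq_iff hb.ne']
    linarith
  · rw [show 2 * m + 1 + 2 = 2 * (m + 1) + 1 by ring, height_odd hp (by omega), HOdd]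
    have e : (p : ℤ) = m + 2 := by omega
    push_cast
    rw [e, show (m : ℤ) + 2 - (m + 1 + 1) = 0 by ring,
      show (m : ℤ) + 2 + 1 - (m + 1 + 1) = 1 by ring,
      show (m : ℤ) + 2 - 1 - (m + 1 + 1) = -1 by ring, B_one hp, B_neg_one hp, B_zero]
    norm_num

end Sequences

/-! ### The domain `Ω_α` -/

/-- The existential form suits invariance, the pieces suit Ω_α. They agree because heights increase:
a point below H_j stays below later heights, so it can be moved right to the last threshold not
exceeding it. -/
theorem Staircase.mem_region_iff {L t : ℝ} {M : ℕ} {c H : ℕ → ℝ} (S : Staircase L t M c H)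
    {z : ℝ × ℝ} : z ∈ region t M c H ↔
      (∃ k, 1 ≤ k ∧ k ≤ M + 1 ∧ z ∈ Ico (c k) (c (k + 1)) ×ˢ Icc 0 (H k)) ∨
        z ∈ Ico (c (M + 2)) t ×ˢ Icc 0 (H (M + 2)) := by
  constructor
  · rintro ⟨-, h2, h3, j, hj1, hj2, hj3, hj4⟩
    have hmono : ∀ k, j ≤ k → k ≤ M + 2 → z.2 ≤ H k := fun k h h' =>
      hj4.trans (S.H_mono j k hj1 h h')
    by_contra hcon
    rw [not_or, not_exists] at hcon
    have key : ∀ k, j ≤ k → k ≤ M + 2 → c k ≤ z.1 := by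
      intro k hk
      induction k, hk using Nat.le_induction with
      | base => exact fun _ => hj3
      | succ k hk ih =>
        intro hk'
        by_contra hlt
        exact hcon.1 k ⟨by omega, by omega, ⟨ih (by omega), not_le.mp hlt⟩, h3,
          hmono k hk (by omega)⟩
    exact hcon.2 ⟨⟨key _ hj2 le_rfl, h2⟩, h3, hmono _ hj2 le_rfl⟩
  · rintro (⟨k, h1, h2, ⟨h3, h4⟩, h5, h6⟩ | ⟨⟨h3, h4⟩, h5, h6⟩)
    · exact ⟨(S.c_mono 1 k le_rfl h1 (by omega)).trans h3,
        h4.trans_le ((S.c_mono (k + 1) (M + 2) (by omega) (by omega) le_rfl).trans S.c_last), h5,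
        k, h1, by omega, h3, h6⟩
    · exact ⟨(S.c_mono 1 (M + 2) le_rfl (by omega) le_rfl).trans h3, h4, h5,
        M + 2, by omega, le_rfl, h3, h6⟩

/-- The strict bound c (M + 2) < t makes the digit equal to one, T taking values in a half-open
interval; it fails at α = 1/λ, which is why that case is treated apart. -/
theorem Staircase.T_c {q : ℕ} {α : ℝ} {M : ℕ} {c H : ℕ → ℝ}
    (S : Staircase (lam q) (α * lam q) M c H) (hlt : c (M + 2) < α * lam q) {k : ℕ} (h1 : 1 ≤ k)
    (h2 : k ≤ M) : T q α (c k) = c (k + 2) := by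
  have hneg := S.c_neg k h1 h2
  have habs : |1 / c k| = -1 / c k := by
    rw [abs_of_neg (one_div_neg.mpr hneg), neg_div]
  have hstep := S.c_step k h1 h2
  have hlow := S.c_mono 1 (k + 2) le_rfl (by omega) (by omega)
  have hup := S.c_mono (k + 2) (M + 2) (by omega) (by omega) le_rfl
  rw [S.c_one] at hlow
  have hd : digit q α (c k) = 1 := by
    refine digit_eq_of_mem_Ico S.L_pos hneg.ne 1 ?_
    rw [habs, Int.cast_one, mul_one, ← hstep]
    exact ⟨hlow, hup.trans_lt hlt⟩
  rw [T, if_neg hneg.ne, hd, habs, hstep]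
  norm_num

theorem Staircase.T_right {q : ℕ} {α : ℝ} {M : ℕ} {c H : ℕ → ℝ}
    (S : Staircase (lam q) (α * lam q) M c H) (hlt : c (M + 2) < α * lam q) :
    T q α (α * lam q) = c 2 := by
  have hpos := S.t_pos
  have habs : |1 / (α * lam q)| = 1 / (α * lam q) := abs_of_pos (one_div_pos.mpr hpos)
  have hM := S.one_le
  have hlow := S.c_mono 1 2 le_rfl (by omega) (by omega)
  have hup := S.c_mono 2 (M + 2) (by omega) (by omega) le_rfl
  rw [S.c_one] at hlow
  have hd : digit q α (α * lam q) = 1 := by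
    refine digit_eq_of_mem_Ico S.L_pos hpos.ne' 1 ?_
    rw [habs, Int.cast_one, mul_one, ← S.c_two]
    exact ⟨hlow, hup.trans_lt hlt⟩
  rw [T, if_neg hpos.ne', hd, habs, S.c_two]
  norm_num

section Domain

variable {p m : ℕ} {α : ℝ} {c H : ℕ → ℝ}

theorem Staircase.l_eq {q : ℕ} (S : Staircase (lam q) (α * lam q) (2 * m + 1) c H)
    (hlt : c (2 * m + 1 + 2) < α * lam q) {n : ℕ} (hn : n ≤ m + 1) : l q α n = c (2 * n + 1) := by
  induction n with
  | zero => rw [mul_zero, zero_add, S.c_one]; simp only [l, Function.iterate_zero, id]; ring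
  | succ n ih =>
    have := ih (by omega)
    rw [l] at this ⊢
    rw [Function.iterate_succ_apply', this, S.T_c hlt (by omega) (by omega)]
    congr 1

theorem Staircase.r_eq {q : ℕ} (S : Staircase (lam q) (α * lam q) (2 * m + 1) c H)
    (hlt : c (2 * m + 1 + 2) < α * lam q) {n : ℕ} (hn1 : 1 ≤ n) (hn : n ≤ m + 1) :
    r q α n = c (2 * n) := by
  induction n, hn1 using Nat.le_induction with
  | base => exact S.T_right hlt
  | succ n h1 ih =>
    have := ih (by omega)
    rw [r] at this ⊢
    rw [Function.iterate_succ_apply', this, S.T_c hlt (by omega) (by omega)]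
    congr 1

theorem OmegaGen_eq_region (hm : p = m + 2) (hα₁ : 1 / 2 ≤ α) (hα₂ : α * lam (2 * p) < 1) :
    OmegaGen p α = region (α * lam (2 * p)) (2 * m + 1)
      (threshold (lam (2 * p)) (α * lam (2 * p))) (height (lam (2 * p))) := by
  have hp : 2 ≤ p := by omega
  have hL := le_lam hp
  have S := isStaircase (t := α * lam (2 * p)) hm (by nlinarith) hα₂.le
  have hlt : threshold (lam (2 * p)) (α * lam (2 * p)) (2 * m + 1 + 2) < α * lam (2 * p) := by
    have hd := odd_denom_pos hp hα₂.le (n := m + 1) (by omega)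
    have h := threshold_odd hp hα₂.le (n := m + 1) (by omega)
    have e1 : ((m + 1 : ℕ) : ℤ) + 1 = p := by push_cast; omega
    have e2 : ((m + 1 : ℕ) : ℤ) + 2 = p + 1 := by push_cast; omega
    have e3 : (p : ℤ) - 1 = (m + 1 : ℕ) := by push_cast; omega
    rw [e1] at hd
    rw [e1, e2, B_succ_eq_B_pred hp, e3] at h
    rw [show 2 * m + 1 + 2 = 2 * (m + 1) + 1 by ring, h, div_lt_iff₀ hd]
    have ha0 := B_pos hp (k := (m + 1 : ℕ)) (by omega) (by omega)
    have : (α * lam (2 * p)) ^ 2 < 1 := by nlinarith [S.t_pos]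
    nlinarith [mul_pos ha0 (sub_pos.mpr this)]
  ext z
  have hodd : ∀ n, n ≤ m + 1 → HOdd p (n + 1) = height (lam (2 * p)) (2 * n + 1) := fun n hn =>
    (height_odd hp (by omega)).symm
  have heven : ∀ n, n ≤ m + 1 → HEven p n = height (lam (2 * p)) (2 * n) := fun n hn =>
    (height_even hp (by omega)).symm
  rw [S.mem_region_iff]
  simp only [OmegaGen, mem_union, mem_iUnion, mem_Icc, exists_prop]
  refine or_congr ?_ ?_
  · constructor
    · rintro ⟨n, ⟨hn1, hn2⟩, h | h⟩
      · obtain ⟨n, rfl⟩ : ∃ n', n = n' + 1 := ⟨n - 1, by omega⟩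
        rw [Nat.add_sub_cancel, S.l_eq hlt (by omega), S.r_eq hlt (by omega) (by omega),
          hodd n (by omega)] at h
        exact ⟨2 * n + 1, by omega, by omega, h⟩
      · rw [S.l_eq hlt (by omega), S.r_eq hlt (by omega) (by omega), heven n (by omega)] at h
        exact ⟨2 * n, by omega, by omega, h⟩
    · rintro ⟨k, hk1, hk2, h⟩
      obtain ⟨n, rfl | rfl⟩ := Nat.even_or_odd' k
      · refine ⟨n, ⟨by omega, by omega⟩, Or.inr ?_⟩
        rwa [S.l_eq hlt (by omega), S.r_eq hlt (by omega) (by omega), heven n (by omega)]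
      · refine ⟨n + 1, ⟨by omega, by omega⟩, Or.inl ?_⟩
        rwa [Nat.add_sub_cancel, S.l_eq hlt (by omega), S.r_eq hlt (by omega) (by omega),
          hodd n (by omega)]
  · have e : p - 1 = m + 1 := by omega
    have e' : p = m + 1 + 1 := by omega
    have h := hodd (m + 1) le_rfl
    rw [← e'] at h
    rw [e, S.l_eq hlt le_rfl, h]
    rfl

theorem threshold_one_odd (L : ℝ) (n : ℕ) : threshold L 1 (2 * n + 1) = threshold L 1 (2 * n + 2) := by
  induction n with
  | zero => simp [threshold]
  | succ n ih =>
    rw [show 2 * (n + 1) + 1 = 2 * n + 1 + 2 by ring, show 2 * (n + 1) + 2 = 2 * n + 2 + 2 by ring,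
      threshold, threshold, ih]

/-- At t = 1 the thresholds coincide in pairs and the last one is t, so the odd-indexed pieces are
empty and only the even heights remain. -/
theorem OmegaTop_eq_region (hm : p = m + 2) :
    OmegaTop p = region 1 (2 * m + 1) (threshold (lam (2 * p)) 1) (height (lam (2 * p))) := by
  have hp : 2 ≤ p := by omega
  have hL := lam_lt_two hp
  have S := isStaircase (t := 1) hm (by linarith) le_rfl
  have hlast : threshold (lam (2 * p)) 1 (2 * m + 1 + 2) = 1 := by
    have hd := odd_denom_pos hp le_rfl (n := m + 1) (by omega)
    have h := threshold_odd hp le_rfl (n := m + 1) (by omega)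
    have e1 : ((m + 1 : ℕ) : ℤ) + 1 = p := by push_cast; omega
    have e2 : ((m + 1 : ℕ) : ℤ) + 2 = p + 1 := by push_cast; omega
    have e3 : (p : ℤ) - 1 = (m + 1 : ℕ) := by push_cast; omega
    rw [e1] at hd
    rw [e1, e2, B_succ_eq_B_pred hp, e3] at h
    rw [show 2 * m + 1 + 2 = 2 * (m + 1) + 1 by ring, h, mul_one, mul_one, div_self]
    rw [mul_one] at hd
    exact hd.ne'
  ext z
  rw [S.mem_region_iff, hlast, Ico_self, empty_prod]
  simp only [OmegaTop, mem_iUnion, mem_Icc, exists_prop, mem_empty_iff_false, or_false]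
  have hpiece : ∀ n : ℕ, n + 1 ≤ p →
      Ico ((B (2 * p) n - B (2 * p) (n + 1)) / (B (2 * p) n - B (2 * p) (n - 1)))
        ((B (2 * p) (n + 1) - B (2 * p) (n + 2)) / (B (2 * p) (n + 1) - B (2 * p) n)) ×ˢ
      Icc 0 (B (2 * p) n / B (2 * p) (n + 1)) =
      Ico (threshold (lam (2 * p)) 1 (2 * n)) (threshold (lam (2 * p)) 1 (2 * n + 1)) ×ˢ
        Icc 0 (height (lam (2 * p)) (2 * n)) := by
    intro n hn
    rw [threshold_even hp (by linarith) hn, threshold_odd hp le_rfl hn, height_even hp hn, HEven]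
    simp only [mul_one]
  constructor
  · rintro ⟨n, ⟨h1, h2⟩, h⟩
    rw [hpiece n (by omega)] at h
    exact ⟨2 * n, by omega, by omega, h⟩
  · rintro ⟨k, h1, h2, h⟩
    obtain ⟨n, rfl | rfl⟩ := Nat.even_or_odd' k
    · refine ⟨n, ⟨by omega, by omega⟩, ?_⟩
      rwa [hpiece n (by omega)]
    · rw [threshold_one_odd, Ico_self, empty_prod] at h
      exact h.elim

end Domain

end AlphaRosen

end

theorem mainTheorem9 (q p : ℕ) (hq : 4 ≤ q) (hqp : q = 2 * p) (α : ℝ)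
    (hα₁ : 1 / 2 ≤ α) (hα₂ : α ≤ 1 / AlphaRosen.lam q) :
    AlphaRosen.IsNaturalExtension (X := AlphaRosen.LebesguePlane) (Y := AlphaRosen.LebesgueLine)
      (AlphaRosen.Omega p α) (AlphaRosen.nu p α) (AlphaRosen.natMap q α)
      (AlphaRosen.I q α) (AlphaRosen.mu p α) (AlphaRosen.T q α) AlphaRosen.proj := by
  subst hqp
  obtain ⟨m, hm⟩ : ∃ m, p = m + 2 := ⟨p - 2, by omega⟩
  have hL := AlphaRosen.le_lam (p := p) (by omega)
  have hL0 : 0 < AlphaRosen.lam (2 * p) := by linarith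
  have ht : α * AlphaRosen.lam (2 * p) ≤ 1 := (le_div_iff₀ hL0).mp hα₂
  refine (AlphaRosen.isStaircase hm (by nlinarith) ht).isNaturalExtension ?_
  unfold AlphaRosen.Omega
  split_ifs with h
  · have h1 : α * AlphaRosen.lam (2 * p) = 1 := by rw [h]; field_simp
    rw [h1]
    exact AlphaRosen.OmegaTop_eq_region hm
  · have hlt : α < 1 / AlphaRosen.lam (2 * p) := lt_of_le_of_ne hα₂ h
    exact AlphaRosen.OmegaGen_eq_region hm hα₁ ((lt_div_iff₀ hL0).mp hlt)
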